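/- Let $\mathbb H$ be the upper half-plane and let $\Gamma_{1,2}\subset SL_2(\mathbb Z)$ be the subgroup of matrices $\gamma=\begin{pmatrix}a&b\\c&d\end{pmatrix}$ with $ac\equiv bd\equiv 0 \pmod 2$, acting on $\mathbb H$ by $\gamma\tau=\frac{a\tau+b}{c\tau+d}$. For $x\in\mathbb C$, $\tau\in\mathbb H$ put $$\theta(x,\tau)=\sum_{n\in\mathbb Z}e^{\pi i n^2\tau+2\pi i n x},\qquad \kappa(y,x,\tau)=\sum_{n\in\mathbb Z}\frac{e^{\pi i\tau n^2+2\pi i n x}}{e^{2\pi i n\tau}-e^{2\pi i y}}\quad (y\notin\mathbb Z+\mathbb Z\tau),$$ $$\kappa_0(x,\tau)=e^{3\pi i\tau/4}\,\kappa\!\left(\tfrac{\tau+1}{2},x,\tau\right),$$ and for $\gamma\in\Gamma_{1,2}$ put $$\chi(\gamma)=\begin{cases}(-1)^{a/2}e^{\frac{\pi i}{4}(ab+cd)},& a\text{ even},\\(-1)^{c/2}e^{\frac{\pi i}{4}(ab+cd)},& c\text{ even}.\end{cases}$$ (1) For every $\gamma\in\Gamma_{1,2}$ there is exactly one number $\zeta(\gamma)\in\mathbb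 C$ such that, with the principal branch of the square root, $$\theta\!\left(\tfrac{x}{c\tau+d},\gamma\tau\right)=\zeta(\gamma)(c\tau+d)^{1/2}e^{\pi i\frac{cx^2}{c\tau+d}}\,\theta(x,\tau)\qquad(x\in\mathbb C,\ \tau\in\mathbb H).$$ It satisfies $\zeta(\gamma)^8=1$, and $\zeta(\gamma)^2=(-1)^{(d-1)/2}$ if $d$ is odd, $\zeta(\gamma)^2=e^{-\pi i c/2}$ if $c$ is odd (equivalently, $d$ is even). Moreover $\chi$ is a character of $\Gamma_{1,2}$ with values in the fourth roots of unity. (2) For every $\gamma\in\Gamma_{1,2}$ the function $$\kappa_0\!\left(\tfrac{x}{c\tau+d},\gamma\tau\right)-\zeta(\gamma)^{-2}\chi(\gamma)^{-1}(c\tau+d)\,e^{\pi i\left(\frac1{c\tau+d}-1\right)x}\,\kappa_0(x,\tau)$$ of $(x,\tau)$ is holomorphic on $\mathbb C\times\mathbb H$ and is divisible by $\theta(x,\tau)$ in the ring of holomorphic functions on $\mathbb C\times\mathbb H$. (3) Let $G=\mathbb Z^2\rtimes\Gamma_{1,2}$ act on $\mathbb C\times\mathbb H$, where $(m,n)\in\mathbb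 Z^2$ acts by $(x,\tau)\mapsto(x+m+n\tau,\tau)$ and $\gamma$ by $(x,\tau)\mapsto(\frac{x}{c\tau+d},\gamma\tau)$; the quotient is the universal elliptic curve over the stack of elliptic curves with a non-trivial point of order $2$. The pair $(\kappa(\frac{\tau+1}2,x,\tau),\theta(x,\tau))$ is a global section of a rank-$2$ extension bundle on this quotient. Precisely, there is a 1-cocycle $C$ of $G$ with values in the holomorphic maps $\mathbb C\times\mathbb H\to GL_2(\mathbb C)$, that is, $C(gh)(p)=C(g)(hp)\,C(h)(p)$, of the form $$C(m,n)=\begin{pmatrix}e^{\pi i n(\tau+1)}&*\\0&e^{-\pi i n^2\tau-2\pi i n x}\end{pmatrix},\qquad C(\gamma)=\begin{pmatrix}k_\gamma(\tau)\,e^{\pi i\left(\frac1{c\tau+d}-1\right)x}&*\\0&\zeta(\gamma)(c\tau+d)^{1/2}e^{\pi i\frac{cx^2}{c\tau+d}}\end{pmatrix},$$ where $k_\gamma(\tau)=e^{\frac{3\pi i}4(\tau-\gamma\tau)}\zeta(\gamma)^{-2}\chi(\gamma)^{-1}(c\tau+d)$, where $C(1,0)$ is the identity matrix and the upper right entry of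 $C(0,1)$ is $1$, such that the holomorphic column vector $s(x,\tau)=\left(\kappa(\frac{\tau+1}2,x,\tau),\theta(x,\tau)\right)^{T}$ satisfies $s(gp)=C(g)(p)\,s(p)$ for all $g\in G$, $p\in\mathbb C\times\mathbb H$. -/

import Mathlib

open Complex
open UpperHalfPlane hiding I
open scoped Real MatrixGroups Matrix

noncomputable section

namespace AppellKappa

/-- The theta group `Γ_{1,2}`: matrices `(a b; c d)` in `SL₂(ℤ)` with `ac ≡ bd ≡ 0 mod 2`. -/
def Gamma12 : Subgroup SL(2, ℤ) where
  carrier := {γ | 2 ∣ γ 0 0 * γ 1 0 ∧ 2 ∣ γ 0 1 * γ 1 1}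
  one_mem' := by simp
  mul_mem' := by
    rintro γ δ ⟨⟨u, hu⟩, ⟨v, hv⟩⟩ ⟨⟨s, hs⟩, ⟨t, ht⟩⟩
    simp only [Set.mem_ofPred_eq, Matrix.SpecialLinearGroup.coe_mul, Matrix.mul_apply,
      Fin.sum_univ_two]
    constructor
    · exact ⟨u * (δ 0 0) ^ 2 + (γ 0 0 * γ 1 1 + γ 0 1 * γ 1 0) * s + v * (δ 1 0) ^ 2, by
        linear_combination (δ 0 0) ^ 2 * hu + (γ 0 0 * γ 1 1 + γ 0 1 * γ 1 0) * hs
          + (δ 1 0) ^ 2 * hv⟩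
    · exact ⟨u * (δ 0 1) ^ 2 + (γ 0 0 * γ 1 1 + γ 0 1 * γ 1 0) * t + v * (δ 1 1) ^ 2, by
        linear_combination (δ 0 1) ^ 2 * hu + (γ 0 0 * γ 1 1 + γ 0 1 * γ 1 0) * ht
          + (δ 1 1) ^ 2 * hv⟩
  inv_mem' := by
    rintro γ ⟨⟨u, hu⟩, ⟨v, hv⟩⟩
    have hdet : γ 0 0 * γ 1 1 - γ 0 1 * γ 1 0 = 1 := by
      have := γ.det_coe
      rwa [Matrix.det_fin_two] at this
    change 2 ∣ (γ⁻¹ : SL(2, ℤ)) 0 0 * (γ⁻¹ : SL(2, ℤ)) 1 0 ∧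
      2 ∣ (γ⁻¹ : SL(2, ℤ)) 0 1 * (γ⁻¹ : SL(2, ℤ)) 1 1
    rw [Matrix.SpecialLinearGroup.SL2_inv_expl]
    change 2 ∣ γ 1 1 * -γ 1 0 ∧ 2 ∣ -γ 0 1 * γ 0 0
    constructor
    · exact ⟨-((γ 1 1) ^ 2 * u - (γ 1 0) ^ 2 * v), by
        linear_combination (-(γ 1 1) ^ 2) * hu + (γ 1 0) ^ 2 * hv
          + (γ 1 0 * γ 1 1) * hdet⟩
    · exact ⟨-((γ 0 0) ^ 2 * v - (γ 0 1) ^ 2 * u), by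
        linear_combination (-(γ 0 0) ^ 2) * hv + (γ 0 1) ^ 2 * hu
          + (γ 0 0 * γ 0 1) * hdet⟩

/-- The entry `a` of `γ = (a b; c d)`. -/
def ea (γ : Gamma12) : ℤ := (γ : SL(2, ℤ)) 0 0
/-- The entry `b` of `γ = (a b; c d)`. -/
def eb (γ : Gamma12) : ℤ := (γ : SL(2, ℤ)) 0 1
/-- The entry `c` of `γ = (a b; c d)`. -/
def ec (γ : Gamma12) : ℤ := (γ : SL(2, ℤ)) 1 0
/-- The entry `d` of `γ = (a b; c d)`. -/
def ed (γ : Gamma12) : ℤ := (γ : SL(2, ℤ)) 1 1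

/-- The automorphy factor `cτ + d`. -/
def autFactor (γ : Gamma12) (τ : ℍ) : ℂ := (ec γ : ℂ) * (τ : ℂ) + (ed γ : ℂ)

theorem det_eq (γ : Gamma12) : ea γ * ed γ - eb γ * ec γ = 1 := by
  have := (γ : SL(2, ℤ)).det_coe
  rwa [Matrix.det_fin_two] at this

theorem autFactor_ne_zero (γ : Gamma12) (τ : ℍ) : autFactor γ τ ≠ 0 := by
  intro h
  have him := congrArg Complex.im h
  have hre := congrArg Complex.re h
  simp [autFactor, τ.im_ne_zero] at him hre
  have hdet := det_eq γ
  simp [him] at hre hdet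
  simp [hre] at hdet

theorem coe_smul_eq (γ : Gamma12) (τ : ℍ) :
    (((γ : SL(2, ℤ)) • τ : ℍ) : ℂ) = ((ea γ : ℂ) * τ + eb γ) / autFactor γ τ := by
  rw [UpperHalfPlane.coe_specialLinearGroup_apply]
  simp [ea, eb, ec, ed, autFactor]

/-- The action of `Γ_{1,2}` on the lattice `ℤ²` by which conjugation by `γ` moves the translation
`x ↦ x + m + nτ`: `(m, n) ↦ (am - bn, -cm + dn)`. -/
def latticeEquiv (γ : Gamma12) : Multiplicative (ℤ × ℤ) ≃* Multiplicative (ℤ × ℤ) where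
  toFun v := Multiplicative.ofAdd
    (ea γ * v.toAdd.1 - eb γ * v.toAdd.2, -ec γ * v.toAdd.1 + ed γ * v.toAdd.2)
  invFun v := Multiplicative.ofAdd
    (ed γ * v.toAdd.1 + eb γ * v.toAdd.2, ec γ * v.toAdd.1 + ea γ * v.toAdd.2)
  left_inv v := by
    apply Multiplicative.toAdd.injective
    ext
    · simp only [toAdd_ofAdd]; linear_combination v.toAdd.1 * det_eq γ
    · simp only [toAdd_ofAdd]; linear_combination v.toAdd.2 * det_eq γ
  right_inv v := by
    apply Multiplicative.toAdd.injective
    ext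
    · simp only [toAdd_ofAdd]; linear_combination v.toAdd.1 * det_eq γ
    · simp only [toAdd_ofAdd]; linear_combination v.toAdd.2 * det_eq γ
  map_mul' v w := by
    apply Multiplicative.toAdd.injective
    ext
    · simp only [toAdd_ofAdd, toAdd_mul, Prod.fst_add, Prod.snd_add]; ring
    · simp only [toAdd_ofAdd, toAdd_mul, Prod.fst_add, Prod.snd_add]; ring

theorem entries_mul (γ δ : Gamma12) :
    ea (γ * δ) = ea γ * ea δ + eb γ * ec δ ∧ eb (γ * δ) = ea γ * eb δ + eb γ * ed δ ∧
    ec (γ * δ) = ec γ * ea δ + ed γ * ec δ ∧ ed (γ * δ) = ec γ * eb δ + ed γ * ed δ := by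
  simp [ea, eb, ec, ed, Matrix.mul_apply, Fin.sum_univ_two]

/-- `latticeEquiv` as a homomorphism from `Γ_{1,2}`. -/
def latticeHom : Gamma12 →* MulAut (Multiplicative (ℤ × ℤ)) where
  toFun := latticeEquiv
  map_one' := by
    ext v <;> simp [latticeEquiv, ea, eb, ec, ed]
  map_mul' γ δ := by
    obtain ⟨h1, h2, h3, h4⟩ := entries_mul γ δ
    ext v
    · simp only [latticeEquiv, MulAut.mul_apply, MulEquiv.coe_mk, Equiv.coe_fn_mk, toAdd_ofAdd,
        h1, h2]
      ring
    · simp only [latticeEquiv, MulAut.mul_apply, MulEquiv.coe_mk, Equiv.coe_fn_mk, toAdd_ofAdd,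
        h3, h4]
      ring

/-- The group `G = ℤ² ⋊ Γ_{1,2}`. -/
abbrev UnivGroup : Type := Multiplicative (ℤ × ℤ) ⋊[latticeHom] Gamma12

/-- The translation `(m, n)` as an element of `G`. -/
def transl (m n : ℤ) : UnivGroup := SemidirectProduct.inl (Multiplicative.ofAdd (m, n))

/-- The matrix `γ` as an element of `G`. -/
def modular (γ : Gamma12) : UnivGroup := SemidirectProduct.inr γ

theorem autFactor_mul (γ δ : Gamma12) (τ : ℍ) :
    autFactor (γ * δ) τ = autFactor γ ((δ : SL(2, ℤ)) • τ) * autFactor δ τ := by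
  obtain ⟨-, -, h3, h4⟩ := entries_mul γ δ
  have h0 := autFactor_ne_zero δ τ
  rw [autFactor, autFactor, coe_smul_eq, h3, h4]
  field_simp
  simp only [autFactor]
  push_cast
  ring

/-- The action of `G` on `ℂ × ℍ`: `(m, n)` acts by `(x, τ) ↦ (x + m + nτ, τ)` and `γ` acts by
`(x, τ) ↦ (x / (cτ + d), γτ)`.  The quotient is the universal elliptic curve over the stack of
elliptic curves with a non-trivial point of order two. -/
def act (g : UnivGroup) (p : ℂ × ℍ) : ℂ × ℍ :=
  (p.1 / autFactor g.right p.2 + (g.left.toAdd.1 : ℂ)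
      + (g.left.toAdd.2 : ℂ) * (((g.right : SL(2, ℤ)) • p.2 : ℍ) : ℂ),
    (g.right : SL(2, ℤ)) • p.2)

theorem act_mul (g h : UnivGroup) (p : ℂ × ℍ) : act (g * h) p = act g (act h p) := by
  have e1 := autFactor_ne_zero g.right ((h.right : SL(2, ℤ)) • p.2)
  have e2 := autFactor_ne_zero h.right p.2
  have hdet : (ea g.right : ℂ) * ed g.right - eb g.right * ec g.right = 1 := by
    exact_mod_cast det_eq g.right
  refine Prod.ext ?_ ?_
  · simp only [act, SemidirectProduct.mul_right, SemidirectProduct.mul_left, autFactor_mul,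
      Subgroup.coe_mul, mul_smul, toAdd_mul, Prod.fst_add, Prod.snd_add]
    change _ / _ + ((_ + (ea g.right * h.left.toAdd.1 - eb g.right * h.left.toAdd.2) : ℤ) : ℂ)
      + ((_ + (-ec g.right * h.left.toAdd.1 + ed g.right * h.left.toAdd.2) : ℤ) : ℂ) * _ = _
    rw [coe_smul_eq g.right]
    generalize ((h.right : SL(2, ℤ)) • p.2 : ℍ) = σ at *
    push_cast
    field_simp
    simp only [autFactor]
    linear_combination ((ec h.right : ℂ) * p.2 + ed h.right) *
      ((h.left.toAdd.1 : ℂ) + h.left.toAdd.2 * (σ : ℂ)) * hdet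
  · simp only [act, SemidirectProduct.mul_right, Subgroup.coe_mul, mul_smul]

instance univAction : MulAction UnivGroup (ℂ × ℍ) where
  smul := act
  one_smul p := by
    change act 1 p = p
    ext <;> simp [act, autFactor, ec, ed]
  mul_smul := act_mul

/-- Holomorphic functions on `ℂ × ℍ`. -/
def IsHolo (f : ℂ × ℍ → ℂ) : Prop :=
  DifferentiableOn ℂ (fun w : ℂ × ℂ => f (w.1, ofComplex w.2)) {w | 0 < w.2.im}

/-- The ring of holomorphic functions on `ℂ × ℍ`. -/
def holoRing : Subring (ℂ × ℍ → ℂ) where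
  carrier := {f | IsHolo f}
  mul_mem' hf hg := DifferentiableOn.mul hf hg
  one_mem' := differentiableOn_const 1
  add_mem' hf hg := DifferentiableOn.add hf hg
  zero_mem' := differentiableOn_const 0
  neg_mem' hf := DifferentiableOn.neg hf

/-- Riemann's theta function `θ(x, τ) = ∑ₙ exp(πi n² τ + 2πi n x)`. -/
def theta (p : ℂ × ℍ) : ℂ := jacobiTheta₂ p.1 p.2

/-- Appell's function
`κ(y, x, τ) = ∑ₙ exp(πi τ n² + 2πi n x) / (exp(2πi n τ) - exp(2πi y))`. -/
def kappa (y x : ℂ) (τ : ℍ) : ℂ :=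
  ∑' n : ℤ, cexp (π * I * τ * (n : ℂ) ^ 2 + 2 * π * I * n * x) /
    (cexp (2 * π * I * n * τ) - cexp (2 * π * I * y))

/-- `κ((τ + 1)/2, x, τ)`. -/
def kappaHalf (p : ℂ × ℍ) : ℂ := kappa (((p.2 : ℂ) + 1) / 2) p.1 p.2

/-- `κ₀(x, τ) = exp(3πiτ/4) κ((τ + 1)/2, x, τ)`. -/
def kappa0 (p : ℂ × ℍ) : ℂ := cexp (3 * π * I * p.2 / 4) * kappaHalf p

/-- The number `z` is the multiplier of `γ` in the theta transformation law
`θ(x/(cτ+d), γτ) = z (cτ+d)^{1/2} exp(πi c x²/(cτ+d)) θ(x, τ)`,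
with the principal branch of the square root. -/
def IsThetaMultiplier (γ : Gamma12) (z : ℂ) : Prop :=
  ∀ (x : ℂ) (τ : ℍ),
    theta (x / autFactor γ τ, (γ : SL(2, ℤ)) • τ) =
      z * autFactor γ τ ^ (1 / 2 : ℂ) * cexp (π * I * ec γ * x ^ 2 / autFactor γ τ) *
        theta (x, τ)

/-- The explicit value of `ζ(γ)²`. -/
def zetaSq (γ : Gamma12) : ℂ :=
  if Odd (ed γ) then (-1 : ℂ) ^ ((ed γ - 1) / 2) else cexp (-(π * I * ec γ / 2))

/-- The character `χ`; if `a` is odd then `c` is even, so the integer divisions are exact. -/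
def chi (γ : Gamma12) : ℂ :=
  if Even (ea γ) then
    (-1 : ℂ) ^ (ea γ / 2) * cexp (π * I / 4 * ((ea γ * eb γ + ec γ * ed γ : ℤ) : ℂ))
  else
    (-1 : ℂ) ^ (ec γ / 2) * cexp (π * I / 4 * ((ea γ * eb γ + ec γ * ed γ : ℤ) : ℂ))

/-- The factor `exp(πi (1/(cτ+d) - 1) x)`. -/
def etaFactor (γ : Gamma12) (p : ℂ × ℍ) : ℂ :=
  cexp (π * I * (1 / autFactor γ p.2 - 1) * p.1)

/-- `exp(3πi/4 (τ - γτ)) z⁻² χ(γ)⁻¹ (cτ+d)`. -/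
def kFactor (z : ℂ) (γ : Gamma12) (τ : ℍ) : ℂ :=
  cexp (3 * π * I / 4 * ((τ : ℂ) - (((γ : SL(2, ℤ)) • τ : ℍ) : ℂ))) *
    (z ^ 2)⁻¹ * (chi γ)⁻¹ * autFactor γ τ

/-- `κ₀(x/(cτ+d), γτ) - z⁻² χ(γ)⁻¹ (cτ+d) exp(πi (1/(cτ+d) - 1) x) κ₀(x, τ)`
as a function of `(x, τ)`. -/
def kappaDefect (z : ℂ) (γ : Gamma12) (p : ℂ × ℍ) : ℂ :=
  kappa0 (p.1 / autFactor γ p.2, (γ : SL(2, ℤ)) • p.2) -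
    (z ^ 2)⁻¹ * (chi γ)⁻¹ * autFactor γ p.2 * etaFactor γ p * kappa0 p

/-- A 1-cocycle of `G` with values in holomorphic maps `ℂ × ℍ → GL₂(ℂ)`, that is, a rank-two
bundle on the universal elliptic curve with a trivialization of its pull-back to `ℂ × ℍ`. -/
structure IsCocycle (C : UnivGroup → ℂ × ℍ → GL (Fin 2) ℂ) : Prop where
  holo : ∀ g i j, IsHolo (fun p => (C g p : Matrix (Fin 2) (Fin 2) ℂ) i j)
  mul : ∀ g h p, C (g * h) p = C g (h • p) * C h p

/-- `s` is a global holomorphic section of the bundle given by the cocycle `C`. -/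
structure IsSection (C : UnivGroup → ℂ × ℍ → GL (Fin 2) ℂ) (s : ℂ × ℍ → Fin 2 → ℂ) : Prop where
  holo : ∀ i, IsHolo (fun p => s p i)
  equivariant : ∀ g p, s (g • p) = (C g p : Matrix (Fin 2) (Fin 2) ℂ) *ᵥ s p

/-- The bundle given by `C` is an extension of the theta line bundle by the twist, by the functions
`k_γ(τ) = exp(3πi/4 (τ - γτ)) ζ(γ)⁻² χ(γ)⁻¹ (cτ+d)` on `ℍ`, of the line bundle of order two attached to `(τ + 1)/2`, and on
each elliptic curve it is the extension with matrix
`(exp(πi(τ+1)) 1; 0 exp(-πiτ-2πix))` for the translation `x ↦ x + τ`. -/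
structure IsThetaExtension (ζ : Gamma12 → ℂ)
    (C : UnivGroup → ℂ × ℍ → GL (Fin 2) ℂ) : Prop where
  transl_form : ∀ (m n : ℤ) (x : ℂ) (τ : ℍ), ∃ u : ℂ,
    (C (transl m n) (x, τ) : Matrix (Fin 2) (Fin 2) ℂ) =
      !![cexp (π * I * n * (τ + 1)), u;
         0, cexp (-(π * I * (n : ℂ) ^ 2 * τ) - 2 * π * I * n * x)]
  transl_one : ∀ p, C (transl 1 0) p = 1
  transl_tau : ∀ (x : ℂ) (τ : ℍ),
    (C (transl 0 1) (x, τ) : Matrix (Fin 2) (Fin 2) ℂ) =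
      !![cexp (π * I * (τ + 1)), 1; 0, cexp (-(π * I * τ) - 2 * π * I * x)]
  modular_form : ∀ (γ : Gamma12) (x : ℂ) (τ : ℍ), ∃ u : ℂ,
    (C (modular γ) (x, τ) : Matrix (Fin 2) (Fin 2) ℂ) =
      !![kFactor (ζ γ) γ τ * etaFactor γ (x, τ), u;
         0, ζ γ * autFactor γ τ ^ (1 / 2 : ℂ) *
          cexp (π * I * ec γ * x ^ 2 / autFactor γ τ)]

end AppellKappa

end

/-!
Normalize Appell's function at `y = (τ + 1)/2` so that `x ↦ x + 1` changes its sign. Under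
`τ ↦ -1/τ` it then transforms with weight one up to a multiple of theta by the Mordell integral:
the difference of the two sides is entire in `x` and antiperiodic under both `1` and `τ`, hence
zero. The shift `τ ↦ τ + 2` only contributes a constant, and these two matrices generate `Γ_{1,2}`,
so `κ((τ + 1)/2, x, τ)` transforms under every element of `ℤ² ⋊ Γ_{1,2}` by a scalar cocycle up to
a multiple of theta. Since theta is not a zero divisor among continuous functions, that
multiple is unique, and uniqueness is exactly the cocycle identity for its upper right entry.
-/

noncomputable section

namespace AppellKappa

/-! ### The theta group and its characters -/

theorem entries_parity (γ : Gamma12) :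
    (Odd (ea γ) ∧ Even (eb γ) ∧ Even (ec γ) ∧ Odd (ed γ)) ∨
      (Even (ea γ) ∧ Odd (eb γ) ∧ Odd (ec γ) ∧ Even (ed γ)) := by
  have hac : Even (ea γ * ec γ) := even_iff_two_dvd.2 γ.2.1
  have hbd : Even (eb γ * ed γ) := even_iff_two_dvd.2 γ.2.2
  have hdet : Odd (ea γ * ed γ - eb γ * ec γ) := by rw [det_eq]; exact odd_one
  rw [Int.even_mul] at hac hbd
  rw [Int.odd_sub, Int.odd_mul, Int.even_mul] at hdet
  simp only [← Int.not_even_iff_odd] at *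
  tauto

theorem odd_ec_add_ed (γ : Gamma12) : Odd (ec γ + ed γ) := by
  rcases entries_parity γ with ⟨-, -, hc, hd⟩ | ⟨-, -, hc, hd⟩
  exacts [hc.add_odd hd, hc.add_even hd]

theorem gamma12_ext {γ δ : Gamma12} (ha : ea γ = ea δ) (hb : eb γ = eb δ) (hc : ec γ = ec δ)
    (hd : ed γ = ed δ) : γ = δ := by
  refine Subtype.ext (Matrix.SpecialLinearGroup.ext _ _ fun i j => ?_)
  fin_cases i <;> fin_cases j
  exacts [ha, hb, hc, hd]

/-- The element `(0 -1; 1 0)` of the theta group. -/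
def inversion : Gamma12 := ⟨ModularGroup.S, by
  change 2 ∣ ModularGroup.S 0 0 * ModularGroup.S 1 0 ∧ 2 ∣ ModularGroup.S 0 1 * ModularGroup.S 1 1
  simp [ModularGroup.S]⟩

/-- The element `(1 2; 0 1)` of the theta group. -/
def shiftTwo : Gamma12 := ⟨ModularGroup.T ^ (2 : ℤ), by
  change 2 ∣ (ModularGroup.T ^ (2 : ℤ)).1 0 0 * (ModularGroup.T ^ (2 : ℤ)).1 1 0 ∧
    2 ∣ (ModularGroup.T ^ (2 : ℤ)).1 0 1 * (ModularGroup.T ^ (2 : ℤ)).1 1 1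
  rw [ModularGroup.coe_T_zpow]
  simp⟩

theorem entries_one : ea 1 = 1 ∧ eb 1 = 0 ∧ ec 1 = 0 ∧ ed 1 = 1 := by
  simp [ea, eb, ec, ed]

theorem entries_inversion :
    ea inversion = 0 ∧ eb inversion = -1 ∧ ec inversion = 1 ∧ ed inversion = 0 := by
  simp [ea, eb, ec, ed, inversion, ModularGroup.S]

theorem entries_shiftTwo_zpow (k : ℤ) :
    ea (shiftTwo ^ k) = 1 ∧ eb (shiftTwo ^ k) = 2 * k ∧
      ec (shiftTwo ^ k) = 0 ∧ ed (shiftTwo ^ k) = 1 := by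
  have hcoe : ((shiftTwo ^ k : Gamma12) : SL(2, ℤ)) = ModularGroup.T ^ (2 * k) := by
    rw [SubgroupClass.coe_zpow, shiftTwo, ← zpow_mul]
  simp [ea, eb, ec, ed, hcoe, ModularGroup.coe_T_zpow]

theorem entries_shiftTwo :
    ea shiftTwo = 1 ∧ eb shiftTwo = 2 ∧ ec shiftTwo = 0 ∧ ed shiftTwo = 1 := by
  simpa using entries_shiftTwo_zpow 1

theorem exists_natAbs_add_two_mul_lt {c d : ℤ} (hc : c ≠ 0) (hcd : Odd (c + d)) :
    ∃ k : ℤ, (d + 2 * k * c).natAbs < c.natAbs := by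
  obtain ⟨j, hj⟩ := hcd
  obtain ⟨m, hm⟩ := Int.eq_nat_or_neg c
  have hm0 : 0 < 2 * m := by omega
  have hle := Int.le_bmod (x := d) hm0
  have hlt := Int.bmod_lt (x := d) hm0
  have hbmod : d.bmod (2 * m) = d - 2 * (d.bdiv (2 * m) * m) := by
    rw [Int.bmod_eq_self_sub_bdiv_mul]; push_cast; ring
  have hbound : (d - 2 * (d.bdiv (2 * m) * m)).natAbs < m := by omega
  rcases hm with rfl | rfl
  · exact ⟨-d.bdiv (2 * m), by grind⟩
  · exact ⟨d.bdiv (2 * m), by grind⟩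

theorem shiftTwo_zpow_of_ec_eq_zero {γ : Gamma12} (hc : ec γ = 0) :
    ∃ k : ℤ, γ = shiftTwo ^ k ∨ γ = inversion * inversion * shiftTwo ^ k := by
  have had : ea γ * ed γ = 1 := by simpa [hc] using det_eq γ
  obtain ⟨q, hq⟩ : Even (eb γ) := by
    rcases entries_parity γ with ⟨-, hb, -⟩ | ⟨-, -, hc', -⟩
    · exact hb
    · simp [hc] at hc'
  rcases Int.mul_eq_one_iff_eq_one_or_neg_one.1 had with ⟨ha, hd⟩ | ⟨ha, hd⟩
  · refine ⟨q, .inl (gamma12_ext ?_ ?_ ?_ ?_)⟩ <;>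
      simp only [entries_shiftTwo_zpow, ha, hq, hc, hd, two_mul]
  · refine ⟨-q, .inr (gamma12_ext ?_ ?_ ?_ ?_)⟩ <;>
      simp only [entries_mul, entries_inversion, entries_shiftTwo_zpow, ha, hq, hc, hd] <;> ring

theorem closure_inversion_shiftTwo :
    Subgroup.closure {inversion, shiftTwo} = (⊤ : Subgroup Gamma12) := by
  set K := Subgroup.closure {inversion, shiftTwo}
  have hS : inversion ∈ K := Subgroup.subset_closure (by simp)
  have hT (k : ℤ) : shiftTwo ^ k ∈ K := K.zpow_mem (Subgroup.subset_closure (by simp)) k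
  refine (Subgroup.eq_top_iff' K).2 fun γ => ?_
  induction hn : (ec γ).natAbs using Nat.strong_induction_on generalizing γ with
  | _ n ih =>
    by_cases hc : ec γ = 0
    · obtain ⟨k, rfl | rfl⟩ := shiftTwo_zpow_of_ec_eq_zero hc
      exacts [hT k, K.mul_mem (K.mul_mem hS hS) (hT k)]
    · obtain ⟨k, hk⟩ := exists_natAbs_add_two_mul_lt hc (odd_ec_add_ed γ)
      have hec : ec (γ * shiftTwo ^ k * inversion) = ed γ + 2 * k * ec γ := by
        simp only [entries_mul, entries_inversion, entries_shiftTwo_zpow]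
        ring
      have hmem := ih _ (by rw [← hn, hec]; exact hk) (γ * shiftTwo ^ k * inversion) rfl
      rwa [K.mul_mem_cancel_right hS, K.mul_mem_cancel_right (hT k)] at hmem

theorem map_mul_of_closure_eq_top {G M : Type*} [Group G] [CommMonoid M] {s : Set G}
    (hs : Subgroup.closure s = ⊤) {f : G → M} (hone : f 1 = 1)
    (hmul : ∀ g, ∀ t ∈ s, f (g * t) = f g * f t) (g h : G) : f (g * h) = f g * f h := by
  have hh : h ∈ Subgroup.closure s := hs ▸ Subgroup.mem_top h
  induction hh using Subgroup.closure_induction generalizing g with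
  | mem t ht => exact hmul g t ht
  | one => rw [mul_one, hone, mul_one]
  | mul x y _ _ hx hy => rw [← mul_assoc, hy, hx, hy x, mul_assoc]
  | inv x _ hx =>
    have hinv : f x⁻¹ * f x = 1 := by rw [← hx, inv_mul_cancel, hone]
    rw [← mul_one (f (g * x⁻¹)), ← hinv, mul_left_comm, ← hx, inv_mul_cancel_right, mul_comm]

theorem neg_one_zpow_eq_stdAddChar (k : ℤ) :
    (-1 : ℂ) ^ k = ZMod.stdAddChar ((4 * k : ℤ) : ZMod 8) := by
  rw [ZMod.stdAddChar_coe, ← Complex.exp_pi_mul_I, ← Complex.exp_int_mul]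
  congr 1
  push_cast
  ring

theorem exp_pi_mul_I_div_four_mul_eq_stdAddChar (k : ℤ) :
    cexp (π * I / 4 * k) = ZMod.stdAddChar (k : ZMod 8) := by
  rw [ZMod.stdAddChar_coe]
  congr 1
  push_cast
  ring

theorem chi_of_even {γ : Gamma12} (h : Even (ea γ)) :
    chi γ = ZMod.stdAddChar ((2 * ea γ + (ea γ * eb γ + ec γ * ed γ) : ℤ) : ZMod 8) := by
  rw [chi, if_pos h, neg_one_zpow_eq_stdAddChar, exp_pi_mul_I_div_four_mul_eq_stdAddChar,
    ← AddChar.map_add_eq_mul, ← Int.cast_add]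
  obtain ⟨p, hp⟩ := h
  congr 3
  omega

theorem chi_of_odd {γ : Gamma12} (h : Odd (ea γ)) (hc : Even (ec γ)) :
    chi γ = ZMod.stdAddChar ((2 * ec γ + (ea γ * eb γ + ec γ * ed γ) : ℤ) : ZMod 8) := by
  rw [chi, if_neg (Int.not_even_iff_odd.2 h), neg_one_zpow_eq_stdAddChar,
    exp_pi_mul_I_div_four_mul_eq_stdAddChar, ← AddChar.map_add_eq_mul, ← Int.cast_add]
  obtain ⟨r, hr⟩ := hc
  congr 3
  omega

theorem zetaSq_of_odd {γ : Gamma12} (h : Odd (ed γ)) :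
    zetaSq γ = ZMod.stdAddChar ((2 * (ed γ - 1) : ℤ) : ZMod 8) := by
  rw [zetaSq, if_pos h, neg_one_zpow_eq_stdAddChar]
  obtain ⟨s, hs⟩ := h
  congr 2
  omega

theorem zetaSq_of_even {γ : Gamma12} (h : Even (ed γ)) :
    zetaSq γ = ZMod.stdAddChar ((-2 * ec γ : ℤ) : ZMod 8) := by
  rw [zetaSq, if_neg (Int.not_odd_iff_even.2 h), ← exp_pi_mul_I_div_four_mul_eq_stdAddChar]
  congr 1
  push_cast
  ring

theorem chi_one : chi 1 = 1 := by
  rw [chi_of_odd] <;> simp [entries_one]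

theorem zetaSq_one : zetaSq 1 = 1 := by
  rw [zetaSq_of_odd] <;> simp [entries_one]

theorem chi_inversion : chi inversion = 1 := by
  rw [chi_of_even] <;> simp [entries_inversion]

theorem chi_shiftTwo : chi shiftTwo = ZMod.stdAddChar (2 : ZMod 8) := by
  rw [chi_of_odd] <;> simp [entries_shiftTwo]

theorem chi_mul_inversion (γ : Gamma12) : chi (γ * inversion) = chi γ * chi inversion := by
  have hentries : ea (γ * inversion) = eb γ ∧ eb (γ * inversion) = -ea γ ∧
      ec (γ * inversion) = ed γ ∧ ed (γ * inversion) = -ec γ := by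
    simp [entries_mul, entries_inversion]
  rw [chi_inversion, mul_one]
  rcases entries_parity γ with ⟨ha, hb, hc, hd⟩ | ⟨ha, hb, hc, hd⟩
  · rw [chi_of_odd ha hc, chi_of_even (by rwa [hentries.1])]
    obtain ⟨p, hp⟩ := ha; obtain ⟨q, hq⟩ := hb; obtain ⟨r, hr⟩ := hc; obtain ⟨s, hs⟩ := hd
    simp only [hentries, hp, hq, hr, hs]
    push_cast
    congr 1
    grind
  · rw [chi_of_even ha, chi_of_odd (by rwa [hentries.1]) (by rwa [hentries.2.2.1])]
    obtain ⟨p, hp⟩ := ha; obtain ⟨q, hq⟩ := hb; obtain ⟨r, hr⟩ := hc; obtain ⟨s, hs⟩ := hd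
    simp only [hentries, hp, hq, hr, hs]
    push_cast
    congr 1
    grind

theorem chi_mul_shiftTwo (γ : Gamma12) : chi (γ * shiftTwo) = chi γ * chi shiftTwo := by
  have hentries : ea (γ * shiftTwo) = ea γ ∧ eb (γ * shiftTwo) = 2 * ea γ + eb γ ∧
      ec (γ * shiftTwo) = ec γ ∧ ed (γ * shiftTwo) = 2 * ec γ + ed γ := by
    simp [entries_mul, entries_shiftTwo, mul_comm]
  rw [chi_shiftTwo]
  rcases entries_parity γ with ⟨ha, -, hc, -⟩ | ⟨ha, -, hc, -⟩
  · rw [chi_of_odd ha hc, chi_of_odd (by rwa [hentries.1]) (by rwa [hentries.2.2.1]),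
      ← AddChar.map_add_eq_mul]
    obtain ⟨p, hp⟩ := ha; obtain ⟨r, hr⟩ := hc
    simp only [hentries, hp, hr]
    push_cast
    congr 1
    grind
  · rw [chi_of_even ha, chi_of_even (by rwa [hentries.1]), ← AddChar.map_add_eq_mul]
    obtain ⟨p, hp⟩ := ha; obtain ⟨r, hr⟩ := hc
    simp only [hentries, hp, hr]
    push_cast
    congr 1
    grind

theorem chi_mul (γ δ : Gamma12) : chi (γ * δ) = chi γ * chi δ := by
  refine map_mul_of_closure_eq_top closure_inversion_shiftTwo chi_one ?_ γ δ
  rintro γ t (rfl | rfl)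
  exacts [chi_mul_inversion γ, chi_mul_shiftTwo γ]

theorem zetaSq_inversion : zetaSq inversion = ZMod.stdAddChar (-2 : ZMod 8) := by
  rw [zetaSq_of_even] <;> simp [entries_inversion]

theorem zetaSq_shiftTwo : zetaSq shiftTwo = 1 := by
  rw [zetaSq_of_odd] <;> simp [entries_shiftTwo]

theorem zetaSq_mul_inversion (γ : Gamma12) :
    zetaSq (γ * inversion) = zetaSq γ * zetaSq inversion := by
  have hentries : ec (γ * inversion) = ed γ ∧ ed (γ * inversion) = -ec γ := by
    simp [entries_mul, entries_inversion]
  rw [zetaSq_inversion]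
  rcases entries_parity γ with ⟨-, -, hc, hd⟩ | ⟨-, -, hc, hd⟩
  · rw [zetaSq_of_odd hd, zetaSq_of_even (by simpa [hentries] using hc), hentries.1,
      ← AddChar.map_add_eq_mul]
    obtain ⟨s, hs⟩ := hd
    rw [hs]
    push_cast
    congr 1
    grind
  · rw [zetaSq_of_even hd, zetaSq_of_odd (by simpa [hentries] using hc), hentries.2,
      ← AddChar.map_add_eq_mul]
    push_cast
    congr 1
    ring

theorem zetaSq_mul_shiftTwo (γ : Gamma12) :
    zetaSq (γ * shiftTwo) = zetaSq γ * zetaSq shiftTwo := by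
  have hentries : ec (γ * shiftTwo) = ec γ ∧ ed (γ * shiftTwo) = ec γ * 2 + ed γ := by
    simp [entries_mul, entries_shiftTwo]
  rw [zetaSq_shiftTwo, mul_one]
  rcases entries_parity γ with ⟨-, -, hc, hd⟩ | ⟨-, -, -, hd⟩
  · rw [zetaSq_of_odd hd, zetaSq_of_odd (hentries.2 ▸ (hc.mul_right 2).add_odd hd), hentries.2]
    obtain ⟨r, hr⟩ := hc
    rw [hr]
    push_cast
    congr 1
    grind
  · rw [zetaSq_of_even hd, zetaSq_of_even (hentries.2 ▸ (even_two.mul_left _).add hd), hentries.1]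

theorem zetaSq_mul (γ δ : Gamma12) : zetaSq (γ * δ) = zetaSq γ * zetaSq δ := by
  refine map_mul_of_closure_eq_top closure_inversion_shiftTwo zetaSq_one ?_ γ δ
  rintro γ t (rfl | rfl)
  exacts [zetaSq_mul_inversion γ, zetaSq_mul_shiftTwo γ]

theorem stdAddChar_pow_four_of_even {k : ℤ} (hk : Even k) :
    (ZMod.stdAddChar (k : ZMod 8) : ℂ) ^ 4 = 1 := by
  obtain ⟨l, rfl⟩ := hk
  rw [← AddChar.map_nsmul_eq_pow]
  convert AddChar.map_zero_eq_one _
  push_cast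
  grind

theorem chi_pow_four (γ : Gamma12) : chi γ ^ 4 = 1 := by
  rcases entries_parity γ with ⟨ha, hb, hc, -⟩ | ⟨ha, -, -, hd⟩
  · rw [chi_of_odd ha hc]
    exact stdAddChar_pow_four_of_even
      ((even_two_mul _).add ((hb.mul_left _).add (hc.mul_right _)))
  · rw [chi_of_even ha]
    exact stdAddChar_pow_four_of_even
      ((even_two_mul _).add ((ha.mul_right _).add (hd.mul_left _)))

theorem zetaSq_pow_four (γ : Gamma12) : zetaSq γ ^ 4 = 1 := by
  rcases entries_parity γ with ⟨-, -, -, hd⟩ | ⟨-, -, -, hd⟩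
  · rw [zetaSq_of_odd hd]
    exact stdAddChar_pow_four_of_even (even_two_mul _)
  · rw [zetaSq_of_even hd]
    exact stdAddChar_pow_four_of_even (even_two.neg.mul_right _)

theorem chi_ne_zero (γ : Gamma12) : chi γ ≠ 0 := fun h => by
  simpa [h] using chi_pow_four γ

theorem zetaSq_ne_zero (γ : Gamma12) : zetaSq γ ≠ 0 := fun h => by
  simpa [h] using zetaSq_pow_four γ

/-! ### Holomorphy of the Appell series -/

section NormalConvergence

open MeasureTheory Metric

variable {E F : Type*} [NormedAddCommGroup E] [NormedSpace ℂ E] [NormedAddCommGroup F]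
  [NormedSpace ℂ F] {x₀ : E} {r : ℝ}

theorem differentiableAt_integral_of_norm_le {α : Type*} [MeasurableSpace α]
    {μ : Measure α} {f : E → α → F} {b : α → ℝ} (hr : 0 < r)
    (hmeas : ∀ x ∈ ball x₀ r, AEStronglyMeasurable (f x) μ)
    (hmeas' : AEStronglyMeasurable (fun a => fderiv ℂ (f · a) x₀) μ)
    (hd : ∀ a, DifferentiableOn ℂ (f · a) (ball x₀ r))
    (hb : ∀ a, ∀ x ∈ ball x₀ r, ‖f x a‖ ≤ b a) (hint : Integrable b μ) :
    DifferentiableAt ℂ (fun x => ∫ a, f x a ∂μ) x₀ := by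
  have hx₀ : x₀ ∈ ball x₀ r := mem_ball_self hr
  have hlip (a : α) : ∀ x ∈ ball x₀ r, ‖f x a - f x₀ a‖ ≤ 2 * b a / r * ‖x - x₀‖ := by
    intro x hx
    rw [← dist_eq_norm, ← dist_eq_norm]
    refine Complex.dist_le_div_mul_dist_of_mapsTo_ball (hd a) (fun y hy => ?_) hx
    rw [mem_closedBall, dist_eq_norm]
    linarith [norm_sub_le (f y a) (f x₀ a), hb a y hy, hb a _ hx₀]
  exact (hasFDerivAt_integral_of_dominated_loc_of_lip' (ball_mem_nhds x₀ hr) hmeas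
    (hint.mono' (hmeas _ hx₀) (.of_forall fun a => hb a _ hx₀)) hmeas' (.of_forall hlip)
    ((hint.const_mul 2).div_const r) (.of_forall fun a =>
      ((hd a).differentiableAt (ball_mem_nhds x₀ hr)).hasFDerivAt)).2.differentiableAt

theorem differentiableAt_tsum_of_norm_le [CompleteSpace F] {ι : Type*} [Countable ι]
    {f : E → ι → F} {b : ι → ℝ} (hr : 0 < r) (hd : ∀ i, DifferentiableOn ℂ (f · i) (ball x₀ r))
    (hb : ∀ i, ∀ x ∈ ball x₀ r, ‖f x i‖ ≤ b i) (hs : Summable b) :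
    DifferentiableAt ℂ (fun x => ∑' i, f x i) x₀ := by
  let _ : MeasurableSpace ι := ⊤
  have hint : Integrable b Measure.count := integrable_count_iff.2 hs.norm
  refine (differentiableAt_integral_of_norm_le (μ := Measure.count) hr
    (fun x _ => .of_discrete) .of_discrete hd hb hint).congr_of_eventuallyEq ?_
  filter_upwards [ball_mem_nhds x₀ hr] with x hx
  rw [integral_countable (hint.mono' .of_discrete (.of_forall fun i => hb i x hx))]
  simp [Measure.real]

end NormalConvergence

/-- The `n`-th term of the series `κ((τ + 1)/2, x, τ)`; the denominator is rewritten by means of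
`exp(2πi(τ + 1)/2) = -exp(πiτ)`. -/
def kappaTerm (n : ℤ) (x τ : ℂ) : ℂ :=
  jacobiTheta₂_term n x τ / (cexp (2 * π * I * n * τ) + cexp (π * I * τ))

/-- The function `κ((τ + 1)/2, x, τ)` for an arbitrary complex number `τ`. -/
def kappaSeries (x τ : ℂ) : ℂ := ∑' n : ℤ, kappaTerm n x τ

theorem kappaHalf_eq (p : ℂ × ℍ) : kappaHalf p = kappaSeries p.1 p.2 := by
  have hperiod : cexp (2 * π * I * (((p.2 : ℂ) + 1) / 2)) = -cexp (π * I * p.2) := by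
    rw [show 2 * π * I * (((p.2 : ℂ) + 1) / 2) = π * I * p.2 + π * I by ring, Complex.exp_add,
      Complex.exp_pi_mul_I, mul_neg_one]
  refine tsum_congr fun n => ?_
  rw [hperiod, sub_neg_eq_add, kappaTerm, jacobiTheta₂_term]
  ring_nf

theorem norm_mul_one_sub_norm_le_norm_zpow_add {𝕜 : Type*} [NormedField 𝕜] {q : 𝕜}
    (h0 : q ≠ 0) (h1 : ‖q‖ ≤ 1) (n : ℤ) : ‖q‖ * (1 - ‖q‖) ≤ ‖q ^ (2 * n) + q‖ := by
  have hq : 0 < ‖q‖ := norm_pos_iff.2 h0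
  have hnorm : ‖q ^ (2 * n)‖ = ‖q‖ ^ (2 * n) := norm_zpow q _
  rcases le_or_gt n 0 with hn | hn
  · have hone : 1 ≤ ‖q‖ ^ (2 * n) := by
      simpa using zpow_le_zpow_right_of_le_one₀ hq h1 (show 2 * n ≤ 0 by omega)
    have htri := norm_sub_le_norm_add (q ^ (2 * n)) q
    nlinarith
  · have hsq : ‖q‖ ^ (2 * n) ≤ ‖q‖ ^ (2 : ℤ) :=
      zpow_le_zpow_right_of_le_one₀ hq h1 (show 2 ≤ 2 * n by omega)
    have htri := norm_sub_le_norm_add q (q ^ (2 * n))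
    rw [zpow_ofNat] at hsq
    rw [add_comm q] at htri
    nlinarith

theorem norm_exp_pi_mul_I_mul (τ : ℂ) : ‖cexp (π * I * τ)‖ = rexp (-(π * τ.im)) := by
  simp [Complex.norm_exp]

theorem le_norm_kappaDenominator {T U : ℝ} {τ : ℂ} (hT : 0 ≤ T) (hTτ : T ≤ τ.im) (hτU : τ.im ≤ U)
    (n : ℤ) : rexp (-(π * U)) * (1 - rexp (-(π * T))) ≤
      ‖cexp (2 * π * I * n * τ) + cexp (π * I * τ)‖ := by
  have hzpow : cexp (2 * π * I * n * τ) = cexp (π * I * τ) ^ (2 * n) := by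
    rw [← Complex.exp_int_mul]
    congr 1
    push_cast
    ring
  have hle : rexp (-(π * τ.im)) ≤ 1 := by
    rw [Real.exp_le_one_iff]
    nlinarith [Real.pi_pos]
  calc rexp (-(π * U)) * (1 - rexp (-(π * T)))
      ≤ rexp (-(π * τ.im)) * (1 - rexp (-(π * τ.im))) := by
        gcongr
        rw [sub_nonneg, Real.exp_le_one_iff]
        nlinarith [Real.pi_pos]
    _ ≤ ‖cexp (2 * π * I * n * τ) + cexp (π * I * τ)‖ := by
        rw [hzpow, ← norm_exp_pi_mul_I_mul]
        exact norm_mul_one_sub_norm_le_norm_zpow_add (Complex.exp_ne_zero _)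
          (norm_exp_pi_mul_I_mul τ ▸ hle) n

theorem exp_neg_mul_one_sub_exp_neg_pos {T : ℝ} (hT : 0 < T) (U : ℝ) :
    0 < rexp (-(π * U)) * (1 - rexp (-(π * T))) := by
  refine mul_pos (Real.exp_pos _) (sub_pos.2 ?_)
  rw [Real.exp_lt_one_iff]
  nlinarith [Real.pi_pos]

theorem kappaDenominator_ne_zero {τ : ℂ} (hτ : 0 < τ.im) (n : ℤ) :
    cexp (2 * π * I * n * τ) + cexp (π * I * τ) ≠ 0 :=
  norm_pos_iff.1 ((exp_neg_mul_one_sub_exp_neg_pos hτ τ.im).trans_le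
    (le_norm_kappaDenominator hτ.le le_rfl le_rfl n))

theorem norm_kappaTerm_le {S T U : ℝ} {x τ : ℂ} (hT : 0 < T) (hx : |x.im| ≤ S) (hTτ : T ≤ τ.im)
    (hτU : τ.im ≤ U) (n : ℤ) :
    ‖kappaTerm n x τ‖ ≤ (rexp (-(π * U)) * (1 - rexp (-(π * T))))⁻¹ *
      rexp (-π * (T * n ^ 2 - 2 * S * |n|)) := by
  rw [kappaTerm, norm_div, div_eq_inv_mul]
  have hpos := exp_neg_mul_one_sub_exp_neg_pos hT U
  gcongr
  · exact le_norm_kappaDenominator hT.le hTτ hτU n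
  · exact norm_jacobiTheta₂_term_le hT hx hTτ n

theorem summable_kappaTerm_bound (S : ℝ) {T : ℝ} (hT : 0 < T) (c : ℝ) :
    Summable fun n : ℤ => c * rexp (-π * (T * n ^ 2 - 2 * S * |n|)) := by
  simpa using (summable_pow_mul_jacobiTheta₂_term_bound S hT 0).mul_left c

theorem summable_kappaTerm (x : ℂ) {τ : ℂ} (hτ : 0 < τ.im) :
    Summable fun n : ℤ => kappaTerm n x τ :=
  (summable_kappaTerm_bound |x.im| hτ _).of_norm_bounded
    (norm_kappaTerm_le hτ le_rfl le_rfl le_rfl)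

theorem im_bounds_of_mem_ball {q w : ℂ × ℂ} (hw : w ∈ Metric.ball q (q.2.im / 2)) :
    ‖w.1‖ ≤ ‖q.1‖ + q.2.im / 2 ∧ q.2.im / 2 ≤ w.2.im ∧ w.2.im ≤ q.2.im * 2 := by
  rw [mem_ball_iff_norm] at hw
  have hfst : ‖w.1 - q.1‖ < q.2.im / 2 := (norm_fst_le (w - q)).trans_lt hw
  have him : |w.2.im - q.2.im| < q.2.im / 2 := by
    rw [← sub_im]
    exact (Complex.abs_im_le_norm _).trans_lt ((norm_snd_le (w - q)).trans_lt hw)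
  have htri := norm_sub_norm_le w.1 q.1
  rw [abs_lt] at him
  exact ⟨by linarith, by linarith, by linarith⟩

theorem differentiableAt_kappaSeries {q : ℂ × ℂ} (hq : 0 < q.2.im) :
    DifferentiableAt ℂ (fun w : ℂ × ℂ => kappaSeries w.1 w.2) q := by
  have hr : 0 < q.2.im / 2 := half_pos hq
  refine differentiableAt_tsum_of_norm_le hr (fun n w hw => ?_) (fun n w hw => ?_)
    (summable_kappaTerm_bound (‖q.1‖ + q.2.im / 2) hr
      (rexp (-(π * (q.2.im * 2))) * (1 - rexp (-(π * (q.2.im / 2)))))⁻¹)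
  · have hden := kappaDenominator_ne_zero (hr.trans_le (im_bounds_of_mem_ball hw).2.1) n
    apply DifferentiableAt.differentiableWithinAt
    unfold kappaTerm jacobiTheta₂_term
    fun_prop (disch := exact hden)
  · obtain ⟨hfst, hT, hU⟩ := im_bounds_of_mem_ball hw
    exact norm_kappaTerm_le hr ((Complex.abs_im_le_norm _).trans hfst) hT hU n

/-! ### Shifting the line of integration -/

section StripIntegral

open MeasureTheory Filter Topology

variable {E : Type*} [NormedAddCommGroup E] [NormedSpace ℂ E] {g : ℂ → E} {φ : ℝ → ℝ} {h : ℝ}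

theorem tendsto_intervalIntegral_vertical_zero (hh : 0 ≤ h) (hφ : Tendsto φ atTop (𝓝 0))
    (hb : ∀ a : ℝ, a ≠ 0 → ∀ y ∈ Set.Icc 0 h, ‖g (a + y * I)‖ ≤ φ |a|) {l : Filter ℝ}
    (hl : Tendsto (|·|) l atTop) :
    Tendsto (fun a : ℝ => ∫ y in (0 : ℝ)..h, g (a + y * I)) l (𝓝 0) := by
  refine squeeze_zero_norm' ?_ (show Tendsto (fun a => φ |a| * |h - 0|) l (𝓝 0) by
    simpa using (hφ.comp hl).mul_const |h - 0|)
  filter_upwards [hl.eventually_gt_atTop 0] with a ha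
  refine intervalIntegral.norm_integral_le_of_norm_le_const fun y hy => ?_
  rw [Set.uIoc_of_le hh] at hy
  exact hb a (abs_pos.1 ha) y (Set.Ioc_subset_Icc_self hy)

theorem integral_eq_integral_add_mul_I (hh : 0 ≤ h)
    (hg : DifferentiableOn ℂ g (im ⁻¹' Set.Icc 0 h)) (hφ : Tendsto φ atTop (𝓝 0))
    (hb : ∀ a : ℝ, a ≠ 0 → ∀ y ∈ Set.Icc 0 h, ‖g (a + y * I)‖ ≤ φ |a|)
    (h0 : Integrable fun a : ℝ => g a) (h1 : Integrable fun a : ℝ => g (a + h * I)) :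
    ∫ a : ℝ, g a = ∫ a : ℝ, g (a + h * I) := by
  have hrect (R : ℝ) : (∫ a in (-R)..R, g a) - (∫ a in (-R)..R, g (a + h * I)) =
      I • (∫ y in (0 : ℝ)..h, g ((-R : ℝ) + y * I)) - I • ∫ y in (0 : ℝ)..h, g (R + y * I) := by
    have hcauchy := Complex.integral_boundary_rect_eq_zero_of_differentiableOn g (-R : ℝ)
      (R + h * I) (hg.mono fun w hw => by simpa [hh] using hw.2)
    simp only [ofReal_re, ofReal_im, add_re, add_im, mul_re, mul_im, Complex.I_re, Complex.I_im,
      mul_zero, mul_one, sub_self, add_zero, zero_add, ofReal_zero, zero_mul] at hcauchy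
    rw [add_sub_assoc] at hcauchy
    rw [eq_neg_of_add_eq_zero_left hcauchy, neg_sub]
  have hright := tendsto_intervalIntegral_vertical_zero hh hφ hb tendsto_abs_atTop_atTop
  have hleft := (tendsto_intervalIntegral_vertical_zero hh hφ hb tendsto_abs_atBot_atTop).comp
    tendsto_neg_atTop_atBot
  have hsides := (hleft.const_smul I).sub (hright.const_smul I)
  rw [smul_zero, sub_zero] at hsides
  have hlines := (intervalIntegral_tendsto_integral h0 tendsto_neg_atTop_atBot tendsto_id).sub
    (intervalIntegral_tendsto_integral h1 tendsto_neg_atTop_atBot tendsto_id)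
  exact sub_eq_zero.1 (tendsto_nhds_unique hlines (hsides.congr fun R => (hrect R).symm))

end StripIntegral

section HyperbolicCosine

open MeasureTheory Filter Topology

theorem tendsto_sinh_atTop : Tendsto Real.sinh atTop atTop := Real.sinhOrderIso.tendsto_atTop

theorem tendsto_sinh_atBot : Tendsto Real.sinh atBot atBot := Real.sinhOrderIso.tendsto_atBot

theorem exp_abs_le_two_mul_cosh (w : ℝ) : rexp |w| ≤ 2 * Real.cosh w := by
  rw [← Real.cosh_abs, Real.cosh_eq]
  linarith [Real.exp_pos (-|w|)]

theorem integrable_inv_cosh : Integrable fun w : ℝ => (Real.cosh w)⁻¹ := by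
  refine (integrable_inv_one_add_sq.const_mul 4).mono'
    (Real.continuous_cosh.inv₀ fun w => (Real.cosh_pos w).ne').aestronglyMeasurable
    (.of_forall fun w => ?_)
  have hquad := Real.quadratic_le_exp_of_nonneg (abs_nonneg w)
  have hle : 1 + w ^ 2 ≤ 4 * Real.cosh w := by
    rw [sq_abs] at hquad
    linarith [exp_abs_le_two_mul_cosh w, abs_nonneg w]
  have hcosh := Real.cosh_pos w
  rw [Real.norm_of_nonneg (inv_pos.2 hcosh).le]
  field_simp
  linarith

theorem integral_inv_cosh : ∫ w : ℝ, (Real.cosh w)⁻¹ = π := by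
  have hderiv (w : ℝ) : HasDerivAt (fun w => Real.arctan (Real.sinh w)) (Real.cosh w)⁻¹ w := by
    convert! (Real.hasDerivAt_sinh w).arctan using 1
    rw [← Real.cosh_sq']
    field_simp [(Real.cosh_pos w).ne']
  rw [integral_of_hasDerivAt_of_tendsto hderiv integrable_inv_cosh
    (Real.tendsto_arctan_atBot.mono_right nhdsWithin_le_nhds |>.comp tendsto_sinh_atBot)
    (Real.tendsto_arctan_atTop.mono_right nhdsWithin_le_nhds |>.comp tendsto_sinh_atTop)]
  ring

theorem ofReal_inv_cosh_pi_mul (w : ℝ) :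
    (((Real.cosh (π * w))⁻¹ : ℝ) : ℂ) = (Complex.cosh (π * w))⁻¹ := by
  push_cast
  rfl

theorem integrable_inv_cosh_pi_mul : Integrable fun w : ℝ => (Complex.cosh (π * w))⁻¹ :=
  ((integrable_inv_cosh.comp_mul_left' Real.pi_ne_zero).ofReal (𝕜 := ℂ)).congr
    (.of_forall ofReal_inv_cosh_pi_mul)

theorem integral_inv_cosh_pi_mul : ∫ w : ℝ, (Complex.cosh (π * w))⁻¹ = 1 := by
  simp_rw [← ofReal_inv_cosh_pi_mul]
  rw [integral_complex_ofReal, Measure.integral_comp_mul_left (fun w => (Real.cosh w)⁻¹) π,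
    integral_inv_cosh, smul_eq_mul, abs_of_pos (inv_pos.2 Real.pi_pos),
    inv_mul_cancel₀ Real.pi_ne_zero, ofReal_one]

theorem one_le_norm_cosh_pi_mul (w : ℝ) : 1 ≤ ‖Complex.cosh (π * w)‖ := by
  rw [← ofReal_mul, ← Complex.ofReal_cosh, Complex.norm_real]
  exact (Real.one_le_cosh _).trans (le_abs_self _)

theorem cosh_pi_mul_ne_zero (w : ℝ) : Complex.cosh (π * w) ≠ 0 :=
  norm_pos_iff.1 (zero_lt_one.trans_le (one_le_norm_cosh_pi_mul w))

theorem sinh_abs_re_le_norm_cosh (z : ℂ) : Real.sinh |z.re| ≤ ‖Complex.cosh z‖ := by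
  have htri := abs_norm_sub_norm_le (cexp z) (-cexp (-z))
  rw [sub_neg_eq_add, norm_neg, Complex.norm_exp, Complex.norm_exp, neg_re] at htri
  rw [← Real.abs_sinh, Real.sinh_eq, Complex.cosh, norm_div, Complex.norm_two, abs_div,
    abs_of_pos (zero_lt_two (α := ℝ))]
  gcongr

theorem cosh_pi_mul_I_div_two : Complex.cosh (π * (I / 2)) = 0 := by
  rw [show (π * (I / 2) : ℂ) = (π / 2 : ℂ) * I by ring, Complex.cosh_mul_I, Complex.cos_pi_div_two]

theorem cosh_pi_mul_ne_zero_of_mem_strip {w : ℂ} (hw : w.im ∈ Set.Icc (0 : ℝ) 1)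
    (hne : w ≠ I / 2) : Complex.cosh (π * w) ≠ 0 := by
  rw [← Complex.cos_mul_I, Ne, Complex.cos_eq_zero_iff]
  rintro ⟨k, hk⟩
  have hmul : w * I = (2 * k + 1) / 2 :=
    mul_left_cancel₀ (Complex.ofReal_ne_zero.2 Real.pi_ne_zero) (by linear_combination hk)
  have hzero : w = ((-((2 * k + 1) / 2) : ℝ) : ℂ) * I := by
    push_cast
    linear_combination (-I) * hmul + w * Complex.I_sq
  have him : w.im = -((2 * k + 1) / 2) := by
    rw [hzero, Complex.im_ofReal_mul, Complex.I_im, mul_one]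
  rw [him, Set.mem_Icc] at hw
  have hlow : -2 < k := by exact_mod_cast (by linarith [hw.2] : (-2 : ℝ) < k)
  have hupp : k < 0 := by exact_mod_cast (by linarith [hw.1] : (k : ℝ) < 0)
  obtain rfl : k = -1 := by omega
  refine hne (hzero.trans ?_)
  push_cast
  ring

end HyperbolicCosine

/-! ### The Mordell integral -/

section Mordell

open MeasureTheory Filter Topology

/-- The Gaussian `exp(πiτw² - 2πxw)` in the integrand of the Mordell integral. -/
def gaussian (x τ w : ℂ) : ℂ := cexp (π * I * τ * w ^ 2 - 2 * π * x * w)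

/-- The Mordell integral `h(x, τ)`. -/
def mordell (x τ : ℂ) : ℂ := ∫ w : ℝ, gaussian x τ w / Complex.cosh (π * w)

theorem differentiable_gaussian (x τ : ℂ) : Differentiable ℂ (gaussian x τ) := by
  unfold gaussian
  fun_prop

theorem gaussian_add_mul_I (x τ a y : ℂ) : gaussian x τ (a + y * I) =
    cexp (-(π * I * τ * y ^ 2) - 2 * π * I * x * y) * gaussian (x + τ * y) τ a := by
  rw [gaussian, gaussian, ← Complex.exp_add]
  congr 1
  linear_combination (π * I * τ * y ^ 2 + 2 * π * τ * a * y) * Complex.I_sq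

theorem norm_gaussian_le {S T : ℝ} {x τ : ℂ} (hT : 0 < T) (hx : ‖x‖ ≤ S) (hτ : T ≤ τ.im) (a : ℝ) :
    ‖gaussian x τ a‖ ≤ rexp (2 * π * S ^ 2 / T) * rexp (-(π * T / 2) * a ^ 2) := by
  have hre : (π * I * τ * a ^ 2 - 2 * π * x * a : ℂ).re =
      -(π * (τ.im * a ^ 2 + 2 * (x.re * a))) := by
    rw [show (π * I * τ * a ^ 2 - 2 * π * x * a : ℂ) =
      ((π * a ^ 2 : ℝ) : ℂ) * (I * τ) - ((2 * π * a : ℝ) : ℂ) * x by push_cast; ring, sub_re,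
      re_ofReal_mul, re_ofReal_mul, I_mul_re]
    ring
  have hlin : -(S * |a|) ≤ x.re * a := by
    refine (neg_le_neg ?_).trans (neg_abs_le _)
    rw [abs_mul]
    gcongr
    exact (Complex.abs_re_le_norm x).trans hx
  have hsquare : 2 * (S * |a|) ≤ 2 * S ^ 2 / T + T / 2 * a ^ 2 := by
    rw [div_add' _ _ _ hT.ne', le_div_iff₀ hT, ← sq_abs a]
    nlinarith [sq_nonneg (2 * S - T * |a|)]
  have hquad : T * a ^ 2 ≤ τ.im * a ^ 2 := by gcongr
  rw [gaussian, Complex.norm_exp, hre, ← Real.exp_add]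
  gcongr
  calc -(π * (τ.im * a ^ 2 + 2 * (x.re * a)))
      ≤ π * (2 * S ^ 2 / T - T / 2 * a ^ 2) := by
        rw [← mul_neg]
        gcongr
        linarith
    _ = 2 * π * S ^ 2 / T + -(π * T / 2) * a ^ 2 := by ring

theorem norm_mordellIntegrand_le {S T : ℝ} {x τ : ℂ} (hT : 0 < T) (hx : ‖x‖ ≤ S) (hτ : T ≤ τ.im)
    (w : ℝ) : ‖gaussian x τ w / Complex.cosh (π * w)‖ ≤
      rexp (2 * π * S ^ 2 / T) * rexp (-(π * T / 2) * w ^ 2) := by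
  rw [norm_div]
  exact (div_le_self (norm_nonneg _) (one_le_norm_cosh_pi_mul w)).trans
    (norm_gaussian_le hT hx hτ w)

theorem integrable_mordellBound {T : ℝ} (hT : 0 < T) (c : ℝ) :
    Integrable fun w : ℝ => c * rexp (-(π * T / 2) * w ^ 2) :=
  (integrable_exp_neg_mul_sq (by have := Real.pi_pos; positivity)).const_mul c

theorem continuous_mordellIntegrand :
    Continuous fun q : ℝ × ℂ × ℂ => gaussian q.2.1 q.2.2 q.1 / Complex.cosh (π * q.1) := by
  unfold gaussian
  have hcosh : Continuous fun q : ℝ × ℂ × ℂ => Complex.cosh (π * q.1) :=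
    Complex.continuous_cosh.comp (by fun_prop)
  exact Continuous.div (by fun_prop) hcosh fun q => cosh_pi_mul_ne_zero q.1

theorem aestronglyMeasurable_mordellIntegrand (x τ : ℂ) :
    AEStronglyMeasurable fun w : ℝ => gaussian x τ w / Complex.cosh (π * w) :=
  (continuous_mordellIntegrand.comp
    (continuous_id.prodMk (continuous_const (y := (x, τ))))).aestronglyMeasurable

theorem integrable_mordellIntegrand (x : ℂ) {τ : ℂ} (hτ : 0 < τ.im) :
    Integrable fun w : ℝ => gaussian x τ w / Complex.cosh (π * w) :=
  (integrable_mordellBound hτ _).mono' (aestronglyMeasurable_mordellIntegrand x τ)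
    (.of_forall (norm_mordellIntegrand_le hτ le_rfl le_rfl))

theorem differentiableAt_mordell {q : ℂ × ℂ} (hq : 0 < q.2.im) :
    DifferentiableAt ℂ (fun w : ℂ × ℂ => mordell w.1 w.2) q := by
  have hr : 0 < q.2.im / 2 := half_pos hq
  refine differentiableAt_integral_of_norm_le hr
    (fun p _ => aestronglyMeasurable_mordellIntegrand p.1 p.2) ?_ (fun w p _ => ?_)
    (fun w p hp => ?_) (integrable_mordellBound hr
      (rexp (2 * π * (‖q.1‖ + q.2.im / 2) ^ 2 / (q.2.im / 2))))
  · exact ((measurable_fderiv_with_param ℂ (f := fun (w : ℝ) (p : ℂ × ℂ) =>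
      gaussian p.1 p.2 w / Complex.cosh (π * w)) continuous_mordellIntegrand).comp
      measurable_prodMk_right).aestronglyMeasurable
  · apply DifferentiableAt.differentiableWithinAt
    unfold gaussian
    fun_prop (disch := exact cosh_pi_mul_ne_zero w)
  · obtain ⟨hfst, hT, -⟩ := im_bounds_of_mem_ball hp
    exact norm_mordellIntegrand_le hr hfst hT w

theorem gaussian_add_gaussian_add_one (x τ w : ℂ) :
    gaussian x τ w + gaussian (x + 1) τ w =
      2 * gaussian (x + 1 / 2) τ w * Complex.cosh (π * w) := by
  have hexp (s : ℂ) : gaussian (x + 1 / 2) τ w * cexp (s * (π * w)) =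
      gaussian (x + (1 - s) / 2) τ w := by
    rw [gaussian, gaussian, ← Complex.exp_add]
    congr 1
    ring
  have hplus := hexp 1
  have hminus := hexp (-1)
  norm_num at hplus hminus
  rw [Complex.cosh, ← hplus, ← hminus]
  ring

theorem integral_gaussian (x : ℂ) {τ : ℂ} (hτ : 0 < τ.im) :
    ∫ w : ℝ, gaussian x τ w = 1 / (-I * τ) ^ (1 / 2 : ℂ) * cexp (π * I * x ^ 2 / τ) := by
  have hτ0 : τ ≠ 0 := fun h => by simp [h] at hτ
  have hπ : (π : ℂ) ≠ 0 := Complex.ofReal_ne_zero.2 Real.pi_ne_zero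
  have hre : (π * I * τ : ℂ).re < 0 := by
    simpa [mul_assoc] using mul_pos Real.pi_pos hτ
  have harg : (-I * τ).arg ≠ π := by
    rw [Ne, Complex.arg_eq_pi_iff, not_and_or]
    exact .inl (by simpa using hτ.le)
  have hinv : (π / -(π * I * τ) : ℂ) = (-I * τ)⁻¹ := by field_simp
  have hsquare : (0 - (-(2 * π * x)) ^ 2 / (4 * (π * I * τ)) : ℂ) = π * I * x ^ 2 / τ := by
    field_simp
    linear_combination (-4 * π * x ^ 2) * Complex.I_sq
  have hgaussian (w : ℝ) :
      gaussian x τ w = cexp (π * I * τ * w ^ 2 + -(2 * π * x) * w + 0) := by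
    rw [gaussian]
    ring_nf
  simp_rw [hgaussian]
  rw [integral_cexp_quadratic hre, hinv, hsquare, Complex.inv_cpow _ _ harg, one_div (_ ^ _)]

theorem mordell_add_mordell_add_one (x : ℂ) {τ : ℂ} (hτ : 0 < τ.im) :
    mordell x τ + mordell (x + 1) τ =
      2 / (-I * τ) ^ (1 / 2 : ℂ) * cexp (π * I * (x + 1 / 2) ^ 2 / τ) := by
  have hsum (w : ℝ) : gaussian x τ w / Complex.cosh (π * w) +
      gaussian (x + 1) τ w / Complex.cosh (π * w) = 2 * gaussian (x + 1 / 2) τ w := by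
    rw [← add_div, gaussian_add_gaussian_add_one, mul_div_cancel_right₀ _ (cosh_pi_mul_ne_zero w)]
  rw [mordell, mordell, ← integral_add (integrable_mordellIntegrand x hτ)
    (integrable_mordellIntegrand (x + 1) hτ)]
  simp_rw [hsum]
  rw [integral_const_mul, integral_gaussian _ hτ]
  ring

theorem exists_norm_gaussian_le_of_mem_strip (x : ℂ) {τ : ℂ} (hτ : 0 < τ.im) :
    ∃ C : ℝ, ∀ a : ℝ, ∀ y ∈ Set.Icc (0 : ℝ) 1, ‖gaussian x τ (a + y * I)‖ ≤ C := by
  have hcont : Continuous fun y : ℝ => cexp (-(π * I * τ * y ^ 2) - 2 * π * I * x * y) := by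
    fun_prop
  obtain ⟨C, hC⟩ := (isCompact_Icc (a := (0 : ℝ)) (b := 1)).exists_bound_of_continuousOn
    hcont.continuousOn
  refine ⟨C * rexp (2 * π * (‖x‖ + ‖τ‖) ^ 2 / τ.im), fun a y hy => ?_⟩
  have hx : ‖x + τ * y‖ ≤ ‖x‖ + ‖τ‖ := by
    refine (norm_add_le _ _).trans (add_le_add_right ?_ _)
    rw [norm_mul, Complex.norm_real, Real.norm_of_nonneg hy.1]
    exact mul_le_of_le_one_right (norm_nonneg _) hy.2
  have hgauss : ‖gaussian (x + τ * y) τ a‖ ≤ rexp (2 * π * (‖x‖ + ‖τ‖) ^ 2 / τ.im) := by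
    refine (norm_gaussian_le hτ hx le_rfl a).trans (mul_le_of_le_one_right (Real.exp_pos _).le ?_)
    rw [Real.exp_le_one_iff, neg_mul, neg_nonpos]
    have := Real.pi_pos
    positivity
  rw [gaussian_add_mul_I, norm_mul]
  gcongr
  · exact (norm_nonneg _).trans (hC y hy)
  · exact hC y hy

/-- The entire-numerator Mordell kernel `(gaussian x τ w - gaussian x τ (i/2)) / cosh(πw)`, written
as a quotient of divided differences so that it is holomorphic at the zero `i/2` of `cosh(πw)`. -/
def mordellKernel (x τ w : ℂ) : ℂ :=
  dslope (gaussian x τ) (I / 2) w / dslope (fun z => Complex.cosh (π * z)) (I / 2) w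

theorem mordellKernel_of_ne (x τ : ℂ) {w : ℂ} (hw : w ≠ I / 2) :
    mordellKernel x τ w =
      (gaussian x τ w - gaussian x τ (I / 2)) / Complex.cosh (π * w) := by
  rw [mordellKernel, dslope_of_ne _ hw, dslope_of_ne _ hw, slope_def_field, slope_def_field,
    cosh_pi_mul_I_div_two, sub_zero, div_div_div_cancel_right₀ (sub_ne_zero.2 hw)]

theorem dslope_cosh_pi_mul_ne_zero {w : ℂ} (hw : w.im ∈ Set.Icc (0 : ℝ) 1) :
    dslope (fun z => Complex.cosh (π * z)) (I / 2) w ≠ 0 := by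
  rcases eq_or_ne w (I / 2) with rfl | hne
  · have hderiv : HasDerivAt (fun z => Complex.cosh (π * z)) (Complex.sinh (π * (I / 2)) * π)
        (I / 2) := by simpa using ((hasDerivAt_id (I / 2)).const_mul (π : ℂ)).ccosh
    rw [dslope_same, hderiv.deriv, show (π * (I / 2) : ℂ) = (π / 2 : ℂ) * I by ring,
      Complex.sinh_mul_I, Complex.sin_pi_div_two]
    simp [Real.pi_ne_zero]
  · rw [dslope_of_ne _ hne, slope_def_field, cosh_pi_mul_I_div_two, sub_zero]
    exact div_ne_zero (cosh_pi_mul_ne_zero_of_mem_strip hw hne) (sub_ne_zero.2 hne)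

theorem differentiableOn_mordellKernel (x τ : ℂ) :
    DifferentiableOn ℂ (mordellKernel x τ) (im ⁻¹' Set.Icc 0 1) := by
  have hdslope {f : ℂ → ℂ} (hf : Differentiable ℂ f) : Differentiable ℂ (dslope f (I / 2)) := by
    rw [← differentiableOn_univ] at hf ⊢
    rwa [Complex.differentiableOn_dslope univ_mem]
  have hcosh : Differentiable ℂ fun z => Complex.cosh (π * z) := by fun_prop
  exact fun w hw => ((hdslope (differentiable_gaussian x τ) w).div (hdslope hcosh w)
    (dslope_cosh_pi_mul_ne_zero hw)).differentiableWithinAt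

theorem mordellKernel_ofReal (x τ : ℂ) (a : ℝ) :
    mordellKernel x τ a = gaussian x τ a / Complex.cosh (π * a) -
      gaussian x τ (I / 2) * (Complex.cosh (π * a))⁻¹ := by
  rw [mordellKernel_of_ne x τ fun h => by simpa using congrArg Complex.im h]
  ring

theorem mordellKernel_ofReal_add_I (x τ : ℂ) (a : ℝ) :
    mordellKernel x τ (a + I) = gaussian x τ (I / 2) * (Complex.cosh (π * a))⁻¹ -
      cexp (-(π * I * τ) - 2 * π * I * x) * (gaussian (x + τ) τ a / Complex.cosh (π * a)) := by
  have hgauss := gaussian_add_mul_I x τ a 1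
  simp only [one_mul, one_pow, mul_one] at hgauss
  rw [mordellKernel_of_ne x τ fun h => by have := congrArg Complex.im h; norm_num at this, hgauss,
    mul_add, Complex.cosh_add_pi_mul_I]
  ring

theorem exists_norm_mordellKernel_le (x : ℂ) {τ : ℂ} (hτ : 0 < τ.im) :
    ∃ C : ℝ, ∀ a : ℝ, a ≠ 0 → ∀ y ∈ Set.Icc (0 : ℝ) 1,
      ‖mordellKernel x τ (a + y * I)‖ ≤ C / Real.sinh (π * |a|) := by
  obtain ⟨C, hC⟩ := exists_norm_gaussian_le_of_mem_strip x hτ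
  refine ⟨C + ‖gaussian x τ (I / 2)‖, fun a ha y hy => ?_⟩
  have : 0 < Real.sinh (π * |a|) := Real.sinh_pos_iff.2 (mul_pos Real.pi_pos (abs_pos.2 ha))
  have hcosh := sinh_abs_re_le_norm_cosh (π * ((a : ℂ) + y * I))
  rw [re_ofReal_mul, show ((a : ℂ) + y * I).re = a by simp, abs_mul, abs_of_pos Real.pi_pos]
    at hcosh
  rw [mordellKernel_of_ne x τ fun h => ha (by simpa using congrArg Complex.re h), norm_div]
  gcongr
  · exact add_nonneg ((norm_nonneg _).trans (hC a y hy)) (norm_nonneg _)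
  · exact (norm_sub_le _ _).trans (add_le_add_left (hC a y hy) _)

theorem gaussian_I_div_two (x τ : ℂ) :
    gaussian x τ (I / 2) = cexp (-(π * I * τ) / 4 - π * I * x) := by
  rw [gaussian]
  congr 1
  linear_combination (π * I * τ / 4) * Complex.I_sq

theorem mordell_add_mordell_add_tau (x : ℂ) {τ : ℂ} (hτ : 0 < τ.im) :
    mordell x τ + cexp (-(π * I * τ) - 2 * π * I * x) * mordell (x + τ) τ =
      2 * cexp (-(π * I * τ) / 4 - π * I * x) := by
  obtain ⟨C, hC⟩ := exists_norm_mordellKernel_le x hτ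
  have hdecay : Tendsto (fun R : ℝ => C / Real.sinh (π * R)) atTop (𝓝 0) :=
    (tendsto_sinh_atTop.comp (tendsto_id.const_mul_atTop Real.pi_pos)).const_div_atTop C
  have hsech := integrable_inv_cosh_pi_mul.const_mul (gaussian x τ (I / 2))
  have hx := integrable_mordellIntegrand x hτ
  have hshift := (integrable_mordellIntegrand (x + τ) hτ).const_mul
    (cexp (-(π * I * τ) - 2 * π * I * x))
  have hcontour := integral_eq_integral_add_mul_I zero_le_one
    (differentiableOn_mordellKernel x τ) hdecay hC
  simp only [ofReal_one, one_mul, mordellKernel_ofReal, mordellKernel_ofReal_add_I] at hcontour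
  have heq := hcontour (hx.sub hsech) (hsech.sub hshift)
  rw [integral_sub hx hsech, integral_sub hsech hshift, integral_const_mul, integral_const_mul,
    integral_inv_cosh_pi_mul, gaussian_I_div_two] at heq
  rw [mordell, mordell]
  linear_combination heq

end Mordell

/-! ### Functional equations of Appell's function -/

section Appell

theorem kappaSeries_add_one (x τ : ℂ) : kappaSeries (x + 1) τ = kappaSeries x τ := by
  refine tsum_congr fun n => ?_
  rw [kappaTerm, kappaTerm, jacobiTheta₂_term, jacobiTheta₂_term]
  congr 1
  exact Complex.exp_eq_exp_iff_exists_int.2 ⟨n, by ring⟩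

theorem kappaSeries_add_two (x τ : ℂ) : kappaSeries x (τ + 2) = kappaSeries x τ := by
  refine tsum_congr fun n => ?_
  rw [kappaTerm, kappaTerm, jacobiTheta₂_term, jacobiTheta₂_term]
  refine congrArg₂ (· / ·) ?_ (congrArg₂ (· + ·) ?_ ?_)
  · exact Complex.exp_eq_exp_iff_exists_int.2 ⟨n ^ 2, by push_cast; ring⟩
  · exact Complex.exp_eq_exp_iff_exists_int.2 ⟨2 * n, by push_cast; ring⟩
  · exact Complex.exp_eq_exp_iff_exists_int.2 ⟨1, by push_cast; ring⟩

theorem kappaTerm_add_tau (n : ℤ) (x : ℂ) {τ : ℂ} (hτ : 0 < τ.im) :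
    kappaTerm n (x + τ) τ = -cexp (π * I * τ) * kappaTerm n x τ + jacobiTheta₂_term n x τ := by
  have hden := kappaDenominator_ne_zero hτ n
  have hterm : jacobiTheta₂_term n (x + τ) τ =
      jacobiTheta₂_term n x τ * cexp (2 * π * I * n * τ) := by
    rw [jacobiTheta₂_term, jacobiTheta₂_term, ← Complex.exp_add]
    ring_nf
  rw [kappaTerm, kappaTerm, hterm]
  field_simp
  ring

theorem kappaSeries_add_tau (x : ℂ) {τ : ℂ} (hτ : 0 < τ.im) :
    kappaSeries (x + τ) τ = -cexp (π * I * τ) * kappaSeries x τ + jacobiTheta₂ x τ := by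
  rw [kappaSeries, kappaSeries, jacobiTheta₂, ← tsum_mul_left,
    ← Summable.tsum_add ((summable_kappaTerm x hτ).mul_left _)
      ((summable_jacobiTheta₂_term_iff x τ).2 hτ)]
  exact tsum_congr fun n => kappaTerm_add_tau n x hτ

/-- Appell's function `exp(3πiτ/4 - πix) κ((τ + 1)/2, x, τ)`, normalized so that it changes sign
under `x ↦ x + 1` and, up to a multiple of theta, under `x ↦ x + τ`. -/
def appell (x τ : ℂ) : ℂ := cexp (3 * π * I * τ / 4 - π * I * x) * kappaSeries x τ

theorem appell_add_one (x τ : ℂ) : appell (x + 1) τ = -appell x τ := by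
  rw [appell, appell, kappaSeries_add_one,
    show 3 * π * I * τ / 4 - π * I * (x + 1) = 3 * π * I * τ / 4 - π * I * x - π * I by ring,
    Complex.exp_sub_pi_mul_I, neg_mul]

theorem appell_add_tau (x : ℂ) {τ : ℂ} (hτ : 0 < τ.im) :
    appell (x + τ) τ = -appell x τ + cexp (-(π * I * τ) / 4 - π * I * x) * jacobiTheta₂ x τ := by
  have hexp : 3 * π * I * τ / 4 - π * I * (x + τ) = -(π * I * τ) / 4 - π * I * x := by ring
  have hshift : cexp (-(π * I * τ) / 4 - π * I * x) * cexp (π * I * τ) =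
      cexp (3 * π * I * τ / 4 - π * I * x) := by
    rw [← Complex.exp_add]
    ring_nf
  rw [appell, appell, kappaSeries_add_tau x hτ, hexp, ← hshift]
  ring

theorem appell_add_two (x τ : ℂ) : appell x (τ + 2) = cexp (3 * π * I / 2) * appell x τ := by
  rw [appell, appell, kappaSeries_add_two, ← mul_assoc, ← Complex.exp_add]
  ring_nf

theorem differentiableAt_appell {q : ℂ × ℂ} (hq : 0 < q.2.im) :
    DifferentiableAt ℂ (fun w : ℂ × ℂ => appell w.1 w.2) q := by
  have := differentiableAt_kappaSeries hq
  unfold appell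
  fun_prop

theorem neg_I_mul_ne_zero {τ : ℂ} (hτ : 0 < τ.im) : -I * τ ≠ 0 :=
  mul_ne_zero (neg_ne_zero.2 Complex.I_ne_zero) fun h => by simp [h] at hτ

theorem neg_I_mul_cpow_half_ne_zero {τ : ℂ} (hτ : 0 < τ.im) : (-I * τ) ^ (1 / 2 : ℂ) ≠ 0 :=
  fun h => neg_I_mul_ne_zero hτ ((Complex.cpow_eq_zero_iff _ _).1 h).1

theorem neg_one_div_im_pos {τ : ℂ} (hτ : 0 < τ.im) : 0 < (-1 / τ).im := by
  simpa [neg_div] using UpperHalfPlane.im_inv_neg_coe_pos ⟨τ, hτ⟩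

theorem jacobiTheta₂_inversion (x : ℂ) {τ : ℂ} (hτ : 0 < τ.im) :
    jacobiTheta₂ (x / τ) (-1 / τ) =
      (-I * τ) ^ (1 / 2 : ℂ) * cexp (π * I * x ^ 2 / τ) * jacobiTheta₂ x τ := by
  have hcancel : cexp (π * I * x ^ 2 / τ) * cexp (-π * I * x ^ 2 / τ) = 1 := by
    rw [← Complex.exp_add, ← Complex.exp_zero]
    ring_nf
  have hroot := neg_I_mul_cpow_half_ne_zero hτ
  rw [jacobiTheta₂_functional_equation x τ]
  linear_combination (-jacobiTheta₂ (x / τ) (-1 / τ)) * hcancel -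
    jacobiTheta₂ (x / τ) (-1 / τ) * cexp (π * I * x ^ 2 / τ) *
      cexp (-π * I * x ^ 2 / τ) * mul_one_div_cancel hroot

theorem exists_norm_le_of_periodic {E : Type*} [SeminormedAddCommGroup E] {f : ℂ → E} {τ : ℂ}
    (hτ : τ.im ≠ 0) (hf : Continuous f) (h1 : Function.Periodic f 1)
    (hper : Function.Periodic f τ) : ∃ C : ℝ, ∀ x, ‖f x‖ ≤ C := by
  have hK : IsCompact ((fun v : ℝ × ℝ => (v.1 : ℂ) + v.2 * τ) ''
      (Set.Icc (0 : ℝ) 1 ×ˢ Set.Icc (0 : ℝ) 1)) :=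
    (isCompact_Icc.prod isCompact_Icc).image (by fun_prop)
  obtain ⟨C, hC⟩ := hK.exists_bound_of_continuousOn hf.continuousOn
  refine ⟨C, fun x => ?_⟩
  obtain ⟨r, s, rfl⟩ : ∃ r s : ℝ, x = r + s * τ := by
    refine ⟨x.re - x.im / τ.im * τ.re, x.im / τ.im, Complex.ext (by simp) ?_⟩
    simp [hτ]
  have hfract : f (r + s * τ) = f (Int.fract r + Int.fract s * τ) := by
    rw [← hper.sub_int_mul_eq ⌊s⌋, ← h1.sub_int_mul_eq ⌊r⌋, Int.fract, Int.fract]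
    push_cast
    ring_nf
  rw [hfract]
  exact hC _ ⟨(Int.fract r, Int.fract s), ⟨⟨Int.fract_nonneg _, (Int.fract_lt_one _).le⟩,
    ⟨Int.fract_nonneg _, (Int.fract_lt_one _).le⟩⟩, rfl⟩

theorem eq_zero_of_antiperiodic {E : Type*} [NormedAddCommGroup E] [NormedSpace ℂ E] {f : ℂ → E}
    {τ : ℂ} (hτ : τ.im ≠ 0) (hf : Differentiable ℂ f) (h1 : Function.Antiperiodic f 1)
    (hanti : Function.Antiperiodic f τ) : f = 0 := by
  obtain ⟨C, hC⟩ := exists_norm_le_of_periodic hτ hf.continuous.norm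
    (fun x => by simp [h1 x]) (fun x => by simp [hanti x])
  ext x
  have hconst := hf.apply_eq_apply_of_bounded
    (isBounded_iff_forall_norm_le.2 ⟨C, by simpa using hC⟩) (x + 1) x
  rw [h1 x, neg_eq_iff_add_eq_zero, ← two_smul ℂ] at hconst
  simpa using hconst

/-- The failure of Appell's function to transform under `τ ↦ -1/τ` by the Mordell integral. -/
def appellInversionDefect (τ x : ℂ) : ℂ :=
  appell (x / τ) (-1 / τ) - I * τ * appell x τ + I * τ / 2 * mordell x τ * jacobiTheta₂ x τ

variable {τ : ℂ}

theorem differentiable_appellInversionDefect (hτ : 0 < τ.im) :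
    Differentiable ℂ (appellInversionDefect τ) := by
  intro x
  have happell := (differentiableAt_appell (q := (x, τ)) hτ).comp x
    (f := fun x : ℂ => (x, τ)) (by fun_prop)
  have happell' := (differentiableAt_appell (q := (x / τ, -1 / τ)) (neg_one_div_im_pos hτ)).comp x
    (f := fun x : ℂ => (x / τ, -1 / τ)) (by fun_prop)
  have hmordell := (differentiableAt_mordell (q := (x, τ)) hτ).comp x
    (f := fun x : ℂ => (x, τ)) (by fun_prop)
  exact (happell'.sub (happell.const_mul _)).add
    ((hmordell.const_mul _).mul (differentiableAt_jacobiTheta₂_fst x hτ))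

theorem antiperiodic_one_appellInversionDefect (hτ : 0 < τ.im) :
    Function.Antiperiodic (appellInversionDefect τ) 1 := by
  intro x
  set r : ℂ := (-I * τ) ^ (1 / 2 : ℂ) with hr
  have hr0 : r ≠ 0 := neg_I_mul_cpow_half_ne_zero hτ
  have hsq : r * r = -I * τ := by
    rw [hr, ← Complex.cpow_add _ _ (neg_I_mul_ne_zero hτ), add_halves, Complex.cpow_one]
  have htau := appell_add_tau ((x + 1) / τ) (neg_one_div_im_pos hτ)
  rw [show (x + 1) / τ + -1 / τ = x / τ by ring, jacobiTheta₂_inversion _ hτ,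
    jacobiTheta₂_add_left, ← hr] at htau
  have hexp : cexp (-(π * I * (-1 / τ)) / 4 - π * I * ((x + 1) / τ)) *
      cexp (π * I * (x + 1) ^ 2 / τ) = cexp (π * I * (x + 1 / 2) ^ 2 / τ) := by
    rw [← Complex.exp_add]
    ring_nf
  have hmordell : r * (mordell x τ + mordell (x + 1) τ) =
      2 * cexp (π * I * (x + 1 / 2) ^ 2 / τ) := by
    rw [mordell_add_mordell_add_one x hτ, ← hr]
    field_simp
  rw [appellInversionDefect, appellInversionDefect, jacobiTheta₂_add_left, appell_add_one]
  linear_combination htau + r * jacobiTheta₂ x τ * hexp - r / 2 * jacobiTheta₂ x τ * hmordell +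
    (mordell x τ + mordell (x + 1) τ) * jacobiTheta₂ x τ / 2 * hsq

theorem antiperiodic_tau_appellInversionDefect (hτ : 0 < τ.im) :
    Function.Antiperiodic (appellInversionDefect τ) τ := by
  intro x
  have hτ0 : τ ≠ 0 := fun h => by simp [h] at hτ
  have hmordell := mordell_add_mordell_add_tau x hτ
  have htheta := jacobiTheta₂_add_left' x τ
  rw [show -π * I * (τ + 2 * x) = -(π * I * τ) - 2 * π * I * x by ring] at htheta
  rw [appellInversionDefect, appellInversionDefect, add_div, div_self hτ0, appell_add_one,
    appell_add_tau x hτ, htheta]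
  linear_combination I * τ / 2 * jacobiTheta₂ x τ * hmordell

theorem appell_inversion (x : ℂ) (hτ : 0 < τ.im) : appell (x / τ) (-1 / τ) =
    I * τ * appell x τ - I * τ / 2 * mordell x τ * jacobiTheta₂ x τ := by
  have hzero := congrFun (eq_zero_of_antiperiodic hτ.ne' (differentiable_appellInversionDefect hτ)
    (antiperiodic_one_appellInversionDefect hτ) (antiperiodic_tau_appellInversionDefect hτ)) x
  rw [appellInversionDefect, Pi.zero_apply] at hzero
  linear_combination hzero

end Appell

/-! ### Theta as a non-zero-divisor -/

section ThetaNonvanishing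

variable {τ : ℂ}

theorem integral_jacobiTheta₂_term (n : ℤ) (τ : ℂ) :
    ∫ x : ℝ in 0..1, jacobiTheta₂_term n x τ = if n = 0 then 1 else 0 := by
  split_ifs with hn
  · simp [hn, jacobiTheta₂_term]
  · have hc : (2 * π * I * n : ℂ) ≠ 0 := by
      simp [Real.pi_ne_zero, hn, Complex.I_ne_zero]
    have hperiod : cexp (2 * π * I * n) = 1 := Complex.exp_eq_one_iff.2 ⟨n, by ring⟩
    simp only [jacobiTheta₂_term, Complex.exp_add]
    rw [intervalIntegral.integral_mul_const, integral_exp_mul_complex hc]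
    simp [hperiod]

theorem integral_jacobiTheta₂ (hτ : 0 < τ.im) : ∫ x : ℝ in 0..1, jacobiTheta₂ x τ = 1 := by
  have hsum := intervalIntegral.hasSum_intervalIntegral_of_summable_norm (a := 0) (b := 1)
    (f := fun n : ℤ => (⟨fun x : ℝ => jacobiTheta₂_term n x τ, by
      unfold jacobiTheta₂_term; fun_prop⟩ : C(ℝ, ℂ))) ?_
  · simp only [ContinuousMap.coe_mk, integral_jacobiTheta₂_term] at hsum
    exact hsum.unique (hasSum_ite_eq 0 (1 : ℂ))
  · refine (summable_kappaTerm_bound 0 hτ 1).of_nonneg_of_le (fun n => norm_nonneg _) fun n => ?_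
    rw [one_mul, ContinuousMap.norm_le _ (Real.exp_pos _).le]
    exact fun x => norm_jacobiTheta₂_term_le hτ (by simp) le_rfl n

theorem exists_jacobiTheta₂_ne_zero (hτ : 0 < τ.im) : ∃ x, jacobiTheta₂ x τ ≠ 0 := by
  by_contra! h
  simpa [h] using integral_jacobiTheta₂ hτ

end ThetaNonvanishing

/-! ### Holomorphic functions on `ℂ × ℍ` -/

theorem isOpen_im_snd_pos : IsOpen {w : ℂ × ℂ | 0 < w.2.im} :=
  isOpen_lt continuous_const (Complex.continuous_im.comp continuous_snd)

theorem isHolo_of_differentiableAt {f : ℂ × ℍ → ℂ} (F : ℂ × ℂ → ℂ)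
    (hf : ∀ x (τ : ℍ), f (x, τ) = F (x, τ))
    (hF : ∀ q : ℂ × ℂ, 0 < q.2.im → DifferentiableAt ℂ F q) : IsHolo f := by
  have hF' : DifferentiableOn ℂ F {w : ℂ × ℂ | 0 < w.2.im} :=
    fun q hq => (hF q hq).differentiableWithinAt
  refine hF'.congr fun w hw => ?_
  rw [hf, UpperHalfPlane.ofComplex_apply_of_im_pos hw]

theorem isHolo_const (c : ℂ) : IsHolo fun _ => c := differentiableOn_const c

theorem isHolo_fst : IsHolo fun p => p.1 :=
  isHolo_of_differentiableAt Prod.fst (fun _ _ => rfl) fun _ _ => differentiableAt_fst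

theorem isHolo_snd : IsHolo fun p => (p.2 : ℂ) :=
  isHolo_of_differentiableAt Prod.snd (fun _ _ => rfl) fun _ _ => differentiableAt_snd

theorem isHolo_theta : IsHolo theta :=
  isHolo_of_differentiableAt (fun w => jacobiTheta₂ w.1 w.2) (fun _ _ => rfl) fun q hq =>
    (hasFDerivAt_jacobiTheta₂ q.1 hq).differentiableAt

theorem isHolo_kappaHalf : IsHolo kappaHalf :=
  isHolo_of_differentiableAt (fun w => kappaSeries w.1 w.2) (fun _ _ => kappaHalf_eq _)
    fun _ hq => differentiableAt_kappaSeries hq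

theorem isHolo_mordell : IsHolo fun p => mordell p.1 p.2 :=
  isHolo_of_differentiableAt (fun w => mordell w.1 w.2) (fun _ _ => rfl) fun _ hq =>
    differentiableAt_mordell hq

namespace IsHolo

variable {f g : ℂ × ℍ → ℂ}

theorem differentiableAt (hf : IsHolo f) {q : ℂ × ℂ} (hq : 0 < q.2.im) :
    DifferentiableAt ℂ (fun w : ℂ × ℂ => f (w.1, ofComplex w.2)) q :=
  DifferentiableOn.differentiableAt hf (isOpen_im_snd_pos.mem_nhds hq)

theorem mul (hf : IsHolo f) (hg : IsHolo g) : IsHolo fun p => f p * g p :=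
  DifferentiableOn.mul hf hg

theorem add (hf : IsHolo f) (hg : IsHolo g) : IsHolo fun p => f p + g p :=
  DifferentiableOn.add hf hg

theorem sub (hf : IsHolo f) (hg : IsHolo g) : IsHolo fun p => f p - g p :=
  DifferentiableOn.sub hf hg

theorem neg (hf : IsHolo f) : IsHolo fun p => -f p := DifferentiableOn.neg hf

theorem div (hf : IsHolo f) (hg : IsHolo g) (h0 : ∀ p, g p ≠ 0) :
    IsHolo fun p => f p / g p := by
  simp only [div_eq_mul_inv]
  exact DifferentiableOn.mul hf (DifferentiableOn.inv hg fun _ _ => h0 _)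

theorem continuous (hf : IsHolo f) : Continuous f := by
  have hcoe : Continuous fun p : ℂ × ℍ => (p.1, (p.2 : ℂ)) := by fun_prop
  refine (ContinuousOn.comp_continuous (DifferentiableOn.continuousOn hf) hcoe
    fun p => p.2.im_pos).congr fun p => ?_
  simp

theorem comp {T : ℂ × ℍ → ℍ} (hf : IsHolo f) (hg : IsHolo g) (hT : IsHolo fun p => (T p : ℂ)) :
    IsHolo fun p => f (g p, T p) := by
  intro w hw
  have hinner := (hg.differentiableAt hw).prodMk (hT.differentiableAt hw)
  have houter := hf.differentiableAt
    (q := (g (w.1, ofComplex w.2), (T (w.1, ofComplex w.2) : ℂ))) (UpperHalfPlane.im_pos _)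
  simpa [Function.comp_def] using (houter.comp w hinner).differentiableWithinAt

end IsHolo

theorem IsHolo.cexp {f : ℂ × ℍ → ℂ} (hf : IsHolo f) : IsHolo fun p => cexp (f p) :=
  DifferentiableOn.cexp hf

theorem dense_setOf_theta_ne_zero : Dense {p | theta p ≠ 0} := by
  rintro ⟨x, τ⟩
  have han : AnalyticOnNhd ℂ (fun x => jacobiTheta₂ x τ) Set.univ :=
    DifferentiableOn.analyticOnNhd
      (fun x _ => (differentiableAt_jacobiTheta₂_fst x τ.im_pos).differentiableWithinAt) isOpen_univ
  have hne : ∀ᶠ z in nhdsWithin x {x}ᶜ, jacobiTheta₂ z τ ≠ 0 := by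
    refine (han x trivial).eventually_eq_zero_or_eventually_ne_zero.resolve_left fun h0 => ?_
    obtain ⟨y, hy⟩ := exists_jacobiTheta₂_ne_zero τ.im_pos
    exact hy (han.eqOn_zero_of_preconnected_of_eventuallyEq_zero isPreconnected_univ trivial h0
      trivial)
  have hslice : Filter.Tendsto (fun z => (z, τ)) (nhdsWithin x {x}ᶜ) (nhds (x, τ)) :=
    ((Continuous.prodMk_left τ).tendsto x).mono_left nhdsWithin_le_nhds
  exact mem_closure_of_tendsto hslice hne

theorem eq_of_mul_theta_eq {f g : ℂ × ℍ → ℂ} (hf : Continuous f) (hg : Continuous g)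
    (h : ∀ p, f p * theta p = g p * theta p) : f = g :=
  Continuous.ext_on dense_setOf_theta_ne_zero hf hg fun p hp => mul_right_cancel₀ hp (h p)

/-! ### The action of `ℤ² ⋊ Γ_{1,2}` -/

theorem eq_transl_mul_modular (g : UnivGroup) :
    g = transl g.left.toAdd.1 g.left.toAdd.2 * modular g.right :=
  (SemidirectProduct.inl_left_mul_inr_right g).symm

theorem modular_mul (γ δ : Gamma12) : modular (γ * δ) = modular γ * modular δ :=
  map_mul SemidirectProduct.inr γ δ

theorem modular_one : modular 1 = 1 := map_one SemidirectProduct.inr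

theorem autFactor_one (τ : ℍ) : autFactor 1 τ = 1 := by
  simp [autFactor, entries_one]

theorem smul_def (g : UnivGroup) (p : ℂ × ℍ) :
    g • p = (p.1 / autFactor g.right p.2 + g.left.toAdd.1 +
      g.left.toAdd.2 * (((g.right : SL(2, ℤ)) • p.2 : ℍ) : ℂ), (g.right : SL(2, ℤ)) • p.2) := rfl

theorem transl_smul (m n : ℤ) (p : ℂ × ℍ) : transl m n • p = (p.1 + m + n * p.2, p.2) := by
  simp [smul_def, transl, autFactor_one]

theorem modular_smul (γ : Gamma12) (p : ℂ × ℍ) :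
    modular γ • p = (p.1 / autFactor γ p.2, (γ : SL(2, ℤ)) • p.2) := by
  simp [smul_def, modular]

theorem autFactor_inversion (τ : ℍ) : autFactor inversion τ = τ := by
  simp [autFactor, entries_inversion]

theorem autFactor_shiftTwo (τ : ℍ) : autFactor shiftTwo τ = 1 := by
  simp [autFactor, entries_shiftTwo]

theorem coe_inversion_smul (τ : ℍ) : (((inversion : SL(2, ℤ)) • τ : ℍ) : ℂ) = -1 / τ := by
  rw [coe_smul_eq, autFactor_inversion]
  simp [entries_inversion]

theorem coe_shiftTwo_smul (τ : ℍ) : (((shiftTwo : SL(2, ℤ)) • τ : ℍ) : ℂ) = τ + 2 := by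
  rw [coe_smul_eq, autFactor_shiftTwo]
  simp [entries_shiftTwo]

theorem isHolo_autFactor (γ : Gamma12) : IsHolo fun p => autFactor γ p.2 :=
  ((isHolo_const _).mul isHolo_snd).add (isHolo_const _)

theorem isHolo_coe_smul (γ : Gamma12) :
    IsHolo fun p => (((γ : SL(2, ℤ)) • p.2 : ℍ) : ℂ) := by
  simp only [coe_smul_eq]
  exact (((isHolo_const _).mul isHolo_snd).add (isHolo_const _)).div (isHolo_autFactor γ)
    fun p => autFactor_ne_zero γ p.2

theorem IsHolo.comp_smul {f : ℂ × ℍ → ℂ} (hf : IsHolo f) (g : UnivGroup) :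
    IsHolo fun p => f (g • p) :=
  hf.comp (((isHolo_fst.div (isHolo_autFactor g.right) fun p => autFactor_ne_zero _ p.2).add
    (isHolo_const _)).add ((isHolo_const _).mul (isHolo_coe_smul g.right)))
    (isHolo_coe_smul g.right)

/-! ### The multiplier of theta -/

/-- The factor `(cτ+d)^{1/2} exp(πi c x²/(cτ+d))` of the theta transformation law, with the
principal branch of the square root; it is a cocycle only up to sign. -/
def thetaFactor (γ : Gamma12) (p : ℂ × ℍ) : ℂ :=
  autFactor γ p.2 ^ (1 / 2 : ℂ) * cexp (π * I * ec γ * p.1 ^ 2 / autFactor γ p.2)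

theorem isHolo_autFactor_cpow_half (γ : Gamma12) :
    IsHolo fun p => autFactor γ p.2 ^ (1 / 2 : ℂ) := by
  by_cases hc : ec γ = 0
  · simpa [autFactor, hc] using isHolo_const ((ed γ : ℂ) ^ (1 / 2 : ℂ))
  · refine isHolo_of_differentiableAt (fun w => ((ec γ : ℂ) * w.2 + (ed γ : ℂ)) ^ (1 / 2 : ℂ))
      (fun _ _ => rfl) fun q hq => DifferentiableAt.cpow (by fun_prop) (by fun_prop) (Or.inr ?_)
    simp [hc, hq.ne']

theorem isHolo_thetaFactor (γ : Gamma12) : IsHolo (thetaFactor γ) := by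
  have hsq : IsHolo fun p : ℂ × ℍ => π * I * ec γ * p.1 ^ 2 := by
    simp only [sq]
    exact (isHolo_const _).mul (isHolo_fst.mul isHolo_fst)
  exact (isHolo_autFactor_cpow_half γ).mul
    (hsq.div (isHolo_autFactor γ) fun p => autFactor_ne_zero γ p.2).cexp

theorem thetaFactor_ne_zero (γ : Gamma12) (p : ℂ × ℍ) : thetaFactor γ p ≠ 0 :=
  mul_ne_zero (by simp [autFactor_ne_zero]) (Complex.exp_ne_zero _)

theorem thetaFactor_one (p : ℂ × ℍ) : thetaFactor 1 p = 1 := by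
  simp [thetaFactor, autFactor_one, entries_one]

theorem thetaFactor_sq (γ : Gamma12) (p : ℂ × ℍ) :
    thetaFactor γ p ^ 2 =
      autFactor γ p.2 * cexp (2 * π * I * ec γ * p.1 ^ 2 / autFactor γ p.2) := by
  have hroot : (autFactor γ p.2 ^ (1 / 2 : ℂ)) ^ 2 = autFactor γ p.2 := by
    simp [← Complex.cpow_nat_mul]
  rw [thetaFactor, mul_pow, hroot, ← Complex.exp_nat_mul]
  congr 2
  push_cast
  ring

theorem thetaFactor_mul_sq (γ δ : Gamma12) (p : ℂ × ℍ) :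
    (thetaFactor γ (modular δ • p) * thetaFactor δ p) ^ 2 = thetaFactor (γ * δ) p ^ 2 := by
  have hγ := autFactor_ne_zero γ ((δ : SL(2, ℤ)) • p.2)
  have hδ := autFactor_ne_zero δ p.2
  have hdet : (ea δ : ℂ) * ed δ - eb δ * ec δ = 1 := by exact_mod_cast det_eq δ
  have hec : (ec (γ * δ) : ℂ) * autFactor δ p.2 = ec γ + ec δ * autFactor (γ * δ) p.2 := by
    simp only [autFactor, entries_mul]
    push_cast
    linear_combination (ec γ : ℂ) * hdet
  have hexp : 2 * π * I * ec (γ * δ) * p.1 ^ 2 / autFactor (γ * δ) p.2 =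
      2 * π * I * ec γ * (p.1 / autFactor δ p.2) ^ 2 / autFactor γ ((δ : SL(2, ℤ)) • p.2) +
        2 * π * I * ec δ * p.1 ^ 2 / autFactor δ p.2 := by
    rw [autFactor_mul] at hec ⊢
    field_simp
    linear_combination p.1 ^ 2 * hec
  rw [mul_pow, thetaFactor_sq, thetaFactor_sq, thetaFactor_sq, hexp, autFactor_mul,
    Complex.exp_add, modular_smul]
  ring

theorem exists_thetaFactor_mul_eq (γ δ : Gamma12) : ∃ ε : ℂ, ε ^ 2 = 1 ∧
    ∀ p, thetaFactor γ (modular δ • p) * thetaFactor δ p = ε * thetaFactor (γ * δ) p := by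
  have hprod : Continuous fun p => thetaFactor γ (modular δ • p) * thetaFactor δ p :=
    (((isHolo_thetaFactor γ).comp_smul _).mul (isHolo_thetaFactor δ)).continuous
  rcases isPreconnected_univ.eq_or_eq_neg_of_sq_eq hprod.continuousOn
    (isHolo_thetaFactor (γ * δ)).continuous.continuousOn
    (fun p _ => thetaFactor_mul_sq γ δ p) (fun {p} _ => thetaFactor_ne_zero (γ * δ) p) with h | h
  · exact ⟨1, one_pow 2, fun p => by simpa using h (Set.mem_univ p)⟩
  · exact ⟨-1, neg_one_sq, fun p => by simpa using h (Set.mem_univ p)⟩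

theorem isThetaMultiplier_iff {γ : Gamma12} {z : ℂ} : IsThetaMultiplier γ z ↔
    ∀ p, theta (modular γ • p) = z * thetaFactor γ p * theta p := by
  simp only [IsThetaMultiplier, Prod.forall, modular_smul, thetaFactor, mul_assoc]

theorem isThetaMultiplier_one : IsThetaMultiplier 1 1 :=
  isThetaMultiplier_iff.2 fun p => by rw [modular_one, one_smul, thetaFactor_one, one_mul, one_mul]

theorem neg_I_mul_cpow {τ : ℂ} (hτ : 0 < τ.im) (s : ℂ) :
    (-I * τ) ^ s = cexp (-(π * I / 2) * s) * τ ^ s := by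
  have hτ0 : τ ≠ 0 := fun h => by simp [h] at hτ
  have harg : (-I).arg + τ.arg ∈ Set.Ioc (-π) π := by
    rw [Complex.arg_neg_I]
    constructor <;> linarith [Complex.arg_le_pi τ, Complex.arg_nonneg_iff.2 hτ.le, Real.pi_pos]
  rw [Complex.cpow_def_of_ne_zero (neg_I_mul_ne_zero hτ), Complex.cpow_def_of_ne_zero hτ0,
    Complex.log_mul (neg_ne_zero.2 Complex.I_ne_zero) hτ0 harg, Complex.log_neg_I,
    ← Complex.exp_add]
  ring_nf

theorem isThetaMultiplier_inversion :
    IsThetaMultiplier inversion (cexp (-(π * I / 4))) := by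
  intro x τ
  rw [autFactor_inversion, theta, coe_inversion_smul, jacobiTheta₂_inversion x τ.im_pos,
    neg_I_mul_cpow τ.im_pos, theta, show -(π * I / 2) * (1 / 2 : ℂ) = -(π * I / 4) by ring]
  simp [entries_inversion]

theorem isThetaMultiplier_shiftTwo : IsThetaMultiplier shiftTwo 1 := by
  intro x τ
  rw [autFactor_shiftTwo, theta, coe_shiftTwo_smul, div_one, jacobiTheta₂_add_right, theta]
  simp [entries_shiftTwo]

namespace IsThetaMultiplier

variable {γ δ : Gamma12} {z w : ℂ}

theorem unique (hz : IsThetaMultiplier γ z) (hw : IsThetaMultiplier γ w) : z = w := by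
  rw [isThetaMultiplier_iff] at hz hw
  have hcont := (isHolo_thetaFactor γ).continuous
  have hfactor := eq_of_mul_theta_eq (continuous_const.mul hcont) (continuous_const.mul hcont)
    fun p => (hz p).symm.trans (hw p)
  exact mul_right_cancel₀ (thetaFactor_ne_zero γ _) (congrFun hfactor (0, UpperHalfPlane.I))

theorem mul (hz : IsThetaMultiplier γ z) (hw : IsThetaMultiplier δ w) :
    ∃ v, IsThetaMultiplier (γ * δ) v ∧ v ^ 2 = z ^ 2 * w ^ 2 := by
  obtain ⟨ε, hε, hfactor⟩ := exists_thetaFactor_mul_eq γ δ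
  refine ⟨ε * z * w, isThetaMultiplier_iff.2 fun p => ?_, by rw [mul_pow, mul_pow, hε, one_mul]⟩
  rw [modular_mul, mul_smul, isThetaMultiplier_iff.1 hz, isThetaMultiplier_iff.1 hw]
  linear_combination z * w * theta p * hfactor p

theorem inv (hz : IsThetaMultiplier γ z) (hz0 : z ≠ 0) :
    ∃ v, IsThetaMultiplier γ⁻¹ v ∧ v ^ 2 = (z ^ 2)⁻¹ := by
  obtain ⟨ε, hε, hfactor⟩ := exists_thetaFactor_mul_eq γ γ⁻¹
  refine ⟨ε * z⁻¹, isThetaMultiplier_iff.2 fun p => ?_, by rw [mul_pow, hε, one_mul, inv_pow]⟩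
  have htheta := isThetaMultiplier_iff.1 hz (modular γ⁻¹ • p)
  rw [← mul_smul, ← modular_mul, mul_inv_cancel, modular_one, one_smul] at htheta
  have hfactor := hfactor p
  rw [mul_inv_cancel, thetaFactor_one, mul_one] at hfactor
  rw [htheta]
  linear_combination (-theta (modular γ⁻¹ • p)) * hε - ε * theta (modular γ⁻¹ • p) * hfactor -
    ε * thetaFactor γ⁻¹ p * thetaFactor γ (modular γ⁻¹ • p) * theta (modular γ⁻¹ • p) *
      inv_mul_cancel₀ hz0

end IsThetaMultiplier

theorem exists_isThetaMultiplier (γ : Gamma12) :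
    ∃ z, IsThetaMultiplier γ z ∧ z ^ 2 = zetaSq γ := by
  have hγ : γ ∈ Subgroup.closure {inversion, shiftTwo} :=
    closure_inversion_shiftTwo ▸ Subgroup.mem_top γ
  induction hγ using Subgroup.closure_induction with
  | mem γ hγ =>
    rcases hγ with rfl | rfl
    · refine ⟨_, isThetaMultiplier_inversion, ?_⟩
      rw [zetaSq, if_neg (by simp [entries_inversion]), ← Complex.exp_nat_mul,
        entries_inversion.2.2.1]
      congr 1
      push_cast
      ring
    · exact ⟨1, isThetaMultiplier_shiftTwo, by rw [one_pow, zetaSq_shiftTwo]⟩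
  | one => exact ⟨1, isThetaMultiplier_one, by rw [one_pow, zetaSq_one]⟩
  | mul γ δ _ _ hγ hδ =>
    obtain ⟨z, hz, hz2⟩ := hγ
    obtain ⟨w, hw, hw2⟩ := hδ
    rw [zetaSq_mul, ← hz2, ← hw2]
    exact hz.mul hw
  | inv γ _ hγ =>
    obtain ⟨z, hz, hz2⟩ := hγ
    have hz0 : z ≠ 0 := fun h => zetaSq_ne_zero γ (by simp [← hz2, h])
    have hinv : zetaSq γ⁻¹ = (z ^ 2)⁻¹ := by
      rw [hz2]
      exact eq_inv_of_mul_eq_one_left (by rw [← zetaSq_mul, inv_mul_cancel, zetaSq_one])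
    rw [hinv]
    exact hz.inv hz0

/-- The multiplier `ζ(γ)` of the theta transformation law. -/
def zeta (γ : Gamma12) : ℂ := (exists_isThetaMultiplier γ).choose

theorem isThetaMultiplier_zeta (γ : Gamma12) : IsThetaMultiplier γ (zeta γ) :=
  (exists_isThetaMultiplier γ).choose_spec.1

theorem zeta_sq (γ : Gamma12) : zeta γ ^ 2 = zetaSq γ :=
  (exists_isThetaMultiplier γ).choose_spec.2

theorem zeta_pow_eight (γ : Gamma12) : zeta γ ^ 8 = 1 := by
  rw [show 8 = 2 * 4 from rfl, pow_mul, zeta_sq, zetaSq_pow_four]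

theorem zeta_ne_zero (γ : Gamma12) : zeta γ ≠ 0 := fun h => by
  simpa [h] using zeta_pow_eight γ

theorem zeta_one : zeta 1 = 1 := (isThetaMultiplier_zeta 1).unique isThetaMultiplier_one

theorem isThetaMultiplier_iff_eq_zeta {γ : Gamma12} {z : ℂ} :
    IsThetaMultiplier γ z ↔ z = zeta γ :=
  ⟨fun h => h.unique (isThetaMultiplier_zeta γ), fun h => h ▸ isThetaMultiplier_zeta γ⟩

/-! ### The two line bundles -/

/-- The quotient `exp(πix - 3πiτ/4)` of `κ((τ + 1)/2, x, τ)` by Appell's function. -/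
def appellFactor (p : ℂ × ℍ) : ℂ := cexp (π * I * p.1 - 3 * π * I * p.2 / 4)

theorem appellFactor_ne_zero (p : ℂ × ℍ) : appellFactor p ≠ 0 := Complex.exp_ne_zero _

theorem isHolo_appellFactor : IsHolo appellFactor :=
  (((isHolo_const _).mul isHolo_fst).sub (((isHolo_const _).mul isHolo_snd).div (isHolo_const 4)
    fun _ => by norm_num)).cexp

theorem kappaHalf_eq_appellFactor_mul (p : ℂ × ℍ) :
    kappaHalf p = appellFactor p * appell p.1 p.2 := by
  rw [appell, appellFactor, kappaHalf_eq, ← mul_assoc, ← Complex.exp_add]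
  simp

/-- The character `(m, n, γ) ↦ (-1)^(m+n) ζ(γ)⁻² χ(γ)⁻¹` of `ℤ² ⋊ Γ_{1,2}`. -/
def twistChar (g : UnivGroup) : ℂ :=
  (-1 : ℂ) ^ (g.left.toAdd.1 + g.left.toAdd.2) * (zetaSq g.right)⁻¹ * (chi g.right)⁻¹

theorem twistChar_ne_zero (g : UnivGroup) : twistChar g ≠ 0 :=
  mul_ne_zero (mul_ne_zero (zpow_ne_zero _ (by norm_num)) (inv_ne_zero (zetaSq_ne_zero _)))
    (inv_ne_zero (chi_ne_zero _))

theorem neg_one_zpow_latticeHom (γ : Gamma12) (v : Multiplicative (ℤ × ℤ)) :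
    (-1 : ℂ) ^ ((latticeHom γ v).toAdd.1 + (latticeHom γ v).toAdd.2) =
      (-1) ^ (v.toAdd.1 + v.toAdd.2) := by
  change (-1 : ℂ) ^ (ea γ * v.toAdd.1 - eb γ * v.toAdd.2 +
    (-ec γ * v.toAdd.1 + ed γ * v.toAdd.2)) = _
  have heven : Even (ea γ * v.toAdd.1 - eb γ * v.toAdd.2 +
      (-ec γ * v.toAdd.1 + ed γ * v.toAdd.2) - (v.toAdd.1 + v.toAdd.2)) := by
    rcases entries_parity γ with ⟨ha, hb, hc, hd⟩ | ⟨ha, hb, hc, hd⟩ <;>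
      simp only [← Int.not_even_iff_odd] at ha hb hc hd <;>
      simp only [Int.even_sub, Int.even_add, Int.even_mul, even_neg] <;> tauto
  rw [← sub_add_cancel (ea γ * _ - _ + _) (v.toAdd.1 + v.toAdd.2), zpow_add₀ (by norm_num),
    heven.neg_one_zpow, one_mul]

theorem twistChar_mul (g h : UnivGroup) : twistChar (g * h) = twistChar g * twistChar h := by
  simp only [twistChar, SemidirectProduct.mul_left, SemidirectProduct.mul_right, toAdd_mul,
    Prod.fst_add, Prod.snd_add, zetaSq_mul, chi_mul, mul_inv]
  rw [add_add_add_comm, zpow_add₀ (by norm_num), neg_one_zpow_latticeHom]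
  ring

theorem twistChar_inversion : twistChar (modular inversion) = I := by
  have hzeta : zetaSq inversion = -I := by
    rw [zetaSq, if_neg (by simp [entries_inversion]), entries_inversion.2.2.1,
      ← Complex.exp_neg_pi_div_two_mul_I]
    congr 1
    push_cast
    ring
  simp [twistChar, modular, hzeta, chi_inversion]

theorem twistChar_shiftTwo : twistChar (modular shiftTwo) = cexp (3 * π * I / 2) := by
  have hchi : chi shiftTwo = cexp (π * I / 4 * (2 : ℤ)) := by
    rw [chi_shiftTwo, exp_pi_mul_I_div_four_mul_eq_stdAddChar, Int.cast_ofNat]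
  simp only [twistChar, modular, SemidirectProduct.left_inr, SemidirectProduct.right_inr, hchi,
    zetaSq_shiftTwo, ← Complex.exp_neg, toAdd_one, Prod.fst_zero, Prod.snd_zero, add_zero,
    zpow_zero, inv_one, one_mul]
  exact Complex.exp_eq_exp_iff_exists_int.2 ⟨-1, by push_cast; ring⟩

/-- The cocycle by which `κ((τ + 1)/2, x, τ)` transforms modulo theta: the line bundle of order two
twisted by `k_γ`. -/
def twistMult (g : UnivGroup) (p : ℂ × ℍ) : ℂ :=
  appellFactor (g • p) / appellFactor p * twistChar g * autFactor g.right p.2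

theorem isHolo_twistMult (g : UnivGroup) : IsHolo (twistMult g) :=
  (((isHolo_appellFactor.comp_smul g).div isHolo_appellFactor appellFactor_ne_zero).mul
    (isHolo_const _)).mul (isHolo_autFactor g.right)

theorem twistMult_ne_zero (g : UnivGroup) (p : ℂ × ℍ) : twistMult g p ≠ 0 :=
  mul_ne_zero (mul_ne_zero (div_ne_zero (appellFactor_ne_zero _) (appellFactor_ne_zero _))
    (twistChar_ne_zero g)) (autFactor_ne_zero _ _)

theorem twistMult_mul (g h : UnivGroup) (p : ℂ × ℍ) :
    twistMult (g * h) p = twistMult g (h • p) * twistMult h p := by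
  have hp := appellFactor_ne_zero p
  have hhp := appellFactor_ne_zero (h • p)
  have haut : autFactor (g * h).right p.2 =
      autFactor g.right (h • p).2 * autFactor h.right p.2 := autFactor_mul g.right h.right p.2
  rw [twistMult, twistMult, twistMult, twistChar_mul, mul_smul, haut]
  field_simp

theorem twistMult_one (p : ℂ × ℍ) : twistMult 1 p = 1 := by
  have hmul := twistMult_mul 1 1 p
  rw [mul_one, one_smul] at hmul
  exact (mul_eq_left₀ (twistMult_ne_zero 1 p)).1 hmul.symm

theorem twistMult_transl (m n : ℤ) (p : ℂ × ℍ) :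
    twistMult (transl m n) p = cexp (π * I * n * (p.2 + 1)) := by
  have hchar : twistChar (transl m n) = cexp (π * I * (m + n)) := by
    simp [twistChar, transl, zetaSq_one, chi_one, ← Complex.exp_pi_mul_I, ← Complex.exp_int_mul,
      mul_comm]
  rw [twistMult, hchar, transl_smul, appellFactor, appellFactor, ← Complex.exp_sub,
    ← Complex.exp_add, transl, SemidirectProduct.right_inl, autFactor_one, mul_one]
  exact Complex.exp_eq_exp_iff_exists_int.2 ⟨m, by ring⟩

theorem twistMult_modular (γ : Gamma12) (p : ℂ × ℍ) :
    twistMult (modular γ) p = kFactor (zeta γ) γ p.2 * etaFactor γ p := by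
  have hexp : appellFactor (modular γ • p) / appellFactor p =
      cexp (3 * π * I / 4 * ((p.2 : ℂ) - (((γ : SL(2, ℤ)) • p.2 : ℍ) : ℂ))) * etaFactor γ p := by
    rw [modular_smul, appellFactor, appellFactor, etaFactor, ← Complex.exp_sub, ← Complex.exp_add]
    ring_nf
  rw [twistMult, hexp, kFactor, zeta_sq]
  simp only [twistChar, modular, SemidirectProduct.left_inr, SemidirectProduct.right_inr,
    toAdd_one, Prod.fst_zero, Prod.snd_zero, add_zero, zpow_zero, one_mul]
  ring

/-- The cocycle of the theta line bundle. -/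
def thetaMult (g : UnivGroup) (p : ℂ × ℍ) : ℂ :=
  cexp (-(π * I * (g.left.toAdd.2 : ℂ) ^ 2 * (((g.right : SL(2, ℤ)) • p.2 : ℍ) : ℂ)) -
      2 * π * I * g.left.toAdd.2 * (p.1 / autFactor g.right p.2)) *
    (zeta g.right * thetaFactor g.right p)

theorem isHolo_thetaMult (g : UnivGroup) : IsHolo (thetaMult g) :=
  (((isHolo_const _).mul (isHolo_coe_smul g.right)).neg.sub ((isHolo_const _).mul
    (isHolo_fst.div (isHolo_autFactor g.right) fun p => autFactor_ne_zero _ p.2))).cexp.mul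
    ((isHolo_const _).mul (isHolo_thetaFactor g.right))

theorem thetaMult_ne_zero (g : UnivGroup) (p : ℂ × ℍ) : thetaMult g p ≠ 0 :=
  mul_ne_zero (Complex.exp_ne_zero _) (mul_ne_zero (zeta_ne_zero _) (thetaFactor_ne_zero _ _))

theorem thetaMult_transl (m n : ℤ) (p : ℂ × ℍ) :
    thetaMult (transl m n) p =
      cexp (-(π * I * (n : ℂ) ^ 2 * p.2) - 2 * π * I * n * p.1) := by
  simp [thetaMult, transl, thetaFactor_one, zeta_one, autFactor_one]

theorem thetaMult_modular (γ : Gamma12) (p : ℂ × ℍ) :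
    thetaMult (modular γ) p = zeta γ * thetaFactor γ p := by
  simp [thetaMult, modular]

theorem jacobiTheta₂_add_lattice (x τ : ℂ) (m n : ℤ) :
    jacobiTheta₂ (x + m + n * τ) τ =
      cexp (-(π * I * (n : ℂ) ^ 2 * τ) - 2 * π * I * n * x) * jacobiTheta₂ x τ := by
  conv_rhs => rw [jacobiTheta₂, ← tsum_mul_left, ← (Equiv.addRight n).tsum_eq]
  refine tsum_congr fun k => ?_
  rw [jacobiTheta₂_term, jacobiTheta₂_term, ← Complex.exp_add, Equiv.coe_addRight]
  exact Complex.exp_eq_exp_iff_exists_int.2 ⟨k * m, by push_cast; ring⟩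

theorem theta_smul (g : UnivGroup) (p : ℂ × ℍ) : theta (g • p) = thetaMult g p * theta p := by
  have hsmul : g • p = transl g.left.toAdd.1 g.left.toAdd.2 • modular g.right • p := by
    rw [← mul_smul, ← eq_transl_mul_modular]
  rw [hsmul, thetaMult, mul_assoc, ← isThetaMultiplier_iff.1 (isThetaMultiplier_zeta g.right),
    transl_smul, modular_smul]
  exact jacobiTheta₂_add_lattice _ _ _ _

theorem thetaMult_mul (g h : UnivGroup) (p : ℂ × ℍ) :
    thetaMult (g * h) p = thetaMult g (h • p) * thetaMult h p := by
  refine congrFun (eq_of_mul_theta_eq (isHolo_thetaMult _).continuous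
    (((isHolo_thetaMult g).comp_smul h).mul (isHolo_thetaMult h)).continuous fun p => ?_) p
  rw [← theta_smul, mul_smul, theta_smul, theta_smul, mul_assoc]

/-! ### The extension bundle -/

/-- The holomorphic function `b` is the upper right entry of the cocycle at `g`: it corrects the
transformation of `κ((τ + 1)/2, x, τ)` under `g` by a multiple of theta. -/
def IsOffDiagonal (g : UnivGroup) (b : ℂ × ℍ → ℂ) : Prop :=
  IsHolo b ∧ ∀ p, kappaHalf (g • p) = twistMult g p * kappaHalf p + b p * theta p

theorem IsOffDiagonal.unique {g : UnivGroup} {b b' : ℂ × ℍ → ℂ} (hb : IsOffDiagonal g b)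
    (hb' : IsOffDiagonal g b') : b = b' :=
  eq_of_mul_theta_eq hb.1.continuous hb'.1.continuous fun p => by
    linear_combination hb'.2 p - hb.2 p

theorem isOffDiagonal_one : IsOffDiagonal 1 fun _ => 0 :=
  ⟨isHolo_const 0, fun p => by rw [one_smul, twistMult_one, one_mul, zero_mul, add_zero]⟩

theorem IsOffDiagonal.mul {g h : UnivGroup} {b b' : ℂ × ℍ → ℂ} (hb : IsOffDiagonal g b)
    (hb' : IsOffDiagonal h b') :
    IsOffDiagonal (g * h) fun p => twistMult g (h • p) * b' p + b (h • p) * thetaMult h p := by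
  refine ⟨(((isHolo_twistMult g).comp_smul h).mul hb'.1).add
    ((hb.1.comp_smul h).mul (isHolo_thetaMult h)), fun p => ?_⟩
  rw [mul_smul, hb.2, hb'.2, theta_smul, twistMult_mul]
  ring

theorem IsOffDiagonal.inv {g : UnivGroup} {b : ℂ × ℍ → ℂ} (hb : IsOffDiagonal g b) :
    IsOffDiagonal g⁻¹ fun p => -(twistMult g⁻¹ p * b (g⁻¹ • p) * thetaMult g⁻¹ p) := by
  refine ⟨(((isHolo_twistMult _).mul (hb.1.comp_smul _)).mul (isHolo_thetaMult _)).neg,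
    fun p => ?_⟩
  have hkappa := hb.2 (g⁻¹ • p)
  have htwist := twistMult_mul g g⁻¹ p
  rw [smul_inv_smul] at hkappa
  rw [mul_inv_cancel, twistMult_one] at htwist
  linear_combination (-twistMult g⁻¹ p) * hkappa + kappaHalf (g⁻¹ • p) * htwist -
    twistMult g⁻¹ p * b (g⁻¹ • p) * theta_smul g⁻¹ p

theorem isOffDiagonal_transl_one : IsOffDiagonal (transl 1 0) fun _ => 0 := by
  refine ⟨isHolo_const 0, fun p => ?_⟩
  rw [twistMult_transl, transl_smul, kappaHalf_eq, kappaHalf_eq]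
  simp [kappaSeries_add_one]

theorem isOffDiagonal_transl_tau : IsOffDiagonal (transl 0 1) fun _ => 1 := by
  refine ⟨isHolo_const 1, fun p => ?_⟩
  rw [twistMult_transl, transl_smul, kappaHalf_eq, kappaHalf_eq, theta]
  simp [kappaSeries_add_tau p.1 p.2.im_pos, mul_add, Complex.exp_add]

theorem isOffDiagonal_of_appell {g : UnivGroup} {b : ℂ × ℍ → ℂ} (hb : IsHolo b)
    (happell : ∀ p, appell (g • p).1 (g • p).2 =
      twistChar g * autFactor g.right p.2 * appell p.1 p.2 + b p * theta p) :
    IsOffDiagonal g fun p => appellFactor (g • p) * b p := by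
  refine ⟨(isHolo_appellFactor.comp_smul g).mul hb, fun p => ?_⟩
  have hp := appellFactor_ne_zero p
  rw [kappaHalf_eq_appellFactor_mul, kappaHalf_eq_appellFactor_mul, happell, twistMult]
  field_simp

theorem exists_isOffDiagonal_inversion : ∃ b, IsOffDiagonal (modular inversion) b := by
  refine ⟨_, isOffDiagonal_of_appell (b := fun p => -(I * p.2 / 2) * mordell p.1 p.2)
    ((((isHolo_const I).mul isHolo_snd).div (isHolo_const 2) fun _ => two_ne_zero).neg.mul
      isHolo_mordell) fun p => ?_⟩
  rw [twistChar_inversion, modular_smul, coe_inversion_smul, autFactor_inversion,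
    appell_inversion p.1 p.2.im_pos, modular, SemidirectProduct.right_inr, autFactor_inversion,
    theta]
  ring

theorem exists_isOffDiagonal_shiftTwo : ∃ b, IsOffDiagonal (modular shiftTwo) b := by
  refine ⟨_, isOffDiagonal_of_appell (b := fun _ => 0) (isHolo_const 0) fun p => ?_⟩
  rw [twistChar_shiftTwo, modular_smul, coe_shiftTwo_smul, autFactor_shiftTwo, appell_add_two,
    modular, SemidirectProduct.right_inr, autFactor_shiftTwo, div_one, mul_one, zero_mul, add_zero]

theorem transl_eq_zpow_mul_zpow (m n : ℤ) : transl m n = transl 1 0 ^ m * transl 0 1 ^ n := by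
  simp only [transl, ← map_zpow, ← map_mul, ← ofAdd_zsmul, ← ofAdd_add]
  simp

theorem exists_isOffDiagonal (g : UnivGroup) : ∃ b, IsOffDiagonal g b := by
  let H : Subgroup UnivGroup :=
    { carrier := {g | ∃ b, IsOffDiagonal g b}
      one_mem' := ⟨_, isOffDiagonal_one⟩
      mul_mem' := fun ⟨_, hb⟩ ⟨_, hb'⟩ => ⟨_, hb.mul hb'⟩
      inv_mem' := fun ⟨_, hb⟩ => ⟨_, hb.inv⟩ }
  have htransl (m n : ℤ) : transl m n ∈ H := by
    rw [transl_eq_zpow_mul_zpow]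
    exact H.mul_mem (H.zpow_mem ⟨_, isOffDiagonal_transl_one⟩ _)
      (H.zpow_mem ⟨_, isOffDiagonal_transl_tau⟩ _)
  have hmodular : (⊤ : Subgroup Gamma12) ≤ H.comap SemidirectProduct.inr := by
    rw [← closure_inversion_shiftTwo, Subgroup.closure_le]
    rintro _ (rfl | rfl)
    · exact exists_isOffDiagonal_inversion
    · exact exists_isOffDiagonal_shiftTwo
  change g ∈ H
  rw [eq_transl_mul_modular g]
  exact H.mul_mem (htransl _ _) (hmodular (Subgroup.mem_top g.right))

/-- The upper right entry of the cocycle at `g`. -/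
def offDiagonal (g : UnivGroup) : ℂ × ℍ → ℂ := (exists_isOffDiagonal g).choose

theorem isOffDiagonal_offDiagonal (g : UnivGroup) : IsOffDiagonal g (offDiagonal g) :=
  (exists_isOffDiagonal g).choose_spec

/-- The matrix-valued cocycle with respect to which `(κ((τ + 1)/2, x, τ), θ(x, τ))` is a section:
its diagonal consists of the cocycles of the two line bundles. -/
def extensionCocycle (g : UnivGroup) (p : ℂ × ℍ) : GL (Fin 2) ℂ :=
  Matrix.GeneralLinearGroup.mkOfDetNeZero !![twistMult g p, offDiagonal g p; 0, thetaMult g p] <| by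
    rw [Matrix.det_fin_two_of, mul_zero, sub_zero]
    exact mul_ne_zero (twistMult_ne_zero g p) (thetaMult_ne_zero g p)

theorem coe_extensionCocycle (g : UnivGroup) (p : ℂ × ℍ) :
    (extensionCocycle g p : Matrix (Fin 2) (Fin 2) ℂ) =
      !![twistMult g p, offDiagonal g p; 0, thetaMult g p] := rfl

theorem isCocycle_extensionCocycle : IsCocycle extensionCocycle where
  holo g i j := by
    fin_cases i <;> fin_cases j
    · exact isHolo_twistMult g
    · exact (isOffDiagonal_offDiagonal g).1
    · exact isHolo_const 0
    · exact isHolo_thetaMult g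
  mul g h p := by
    have hoff := congrFun ((isOffDiagonal_offDiagonal (g * h)).unique
      ((isOffDiagonal_offDiagonal g).mul (isOffDiagonal_offDiagonal h))) p
    apply Units.ext
    rw [Units.val_mul, coe_extensionCocycle, coe_extensionCocycle, coe_extensionCocycle, hoff,
      twistMult_mul, thetaMult_mul]
    simp

theorem isThetaExtension_extensionCocycle : IsThetaExtension zeta extensionCocycle where
  transl_form m n x τ :=
    ⟨_, by rw [coe_extensionCocycle, twistMult_transl, thetaMult_transl]⟩
  transl_one p := by
    apply Units.ext
    rw [coe_extensionCocycle, (isOffDiagonal_offDiagonal _).unique isOffDiagonal_transl_one,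
      twistMult_transl, thetaMult_transl]
    simp [Matrix.one_fin_two]
  transl_tau x τ := by
    rw [coe_extensionCocycle, (isOffDiagonal_offDiagonal _).unique isOffDiagonal_transl_tau,
      twistMult_transl, thetaMult_transl]
    simp
  modular_form γ x τ :=
    ⟨_, by rw [coe_extensionCocycle, twistMult_modular, thetaMult_modular, thetaFactor,
      ← mul_assoc]⟩

theorem isSection_extensionCocycle :
    IsSection extensionCocycle fun p => ![kappaHalf p, theta p] where
  holo i := by
    fin_cases i
    · exact isHolo_kappaHalf
    · exact isHolo_theta
  equivariant g p := by
    rw [coe_extensionCocycle, (isOffDiagonal_offDiagonal g).2, theta_smul]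
    ext i
    fin_cases i <;> simp [Matrix.mulVec, dotProduct, Fin.sum_univ_two]

theorem kappaDefect_eq_theta_mul (γ : Gamma12) :
    kappaDefect (zeta γ) γ = theta * fun p =>
      cexp (3 * π * I * (((γ : SL(2, ℤ)) • p.2 : ℍ) : ℂ) / 4) * offDiagonal (modular γ) p := by
  funext p
  have hkappa := (isOffDiagonal_offDiagonal (modular γ)).2 p
  rw [twistMult_modular, modular_smul] at hkappa
  have hexp : cexp (3 * π * I * p.2 / 4) =
      cexp (3 * π * I * (((γ : SL(2, ℤ)) • p.2 : ℍ) : ℂ) / 4) *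
        cexp (3 * π * I / 4 * ((p.2 : ℂ) - (((γ : SL(2, ℤ)) • p.2 : ℍ) : ℂ))) := by
    rw [← Complex.exp_add]
    ring_nf
  rw [kappaDefect, kappa0, kappa0, hkappa, kFactor, hexp, Pi.mul_apply]
  ring

theorem theta_dvd_kappaDefect (γ : Gamma12) :
    ∃ hκ : kappaDefect (zeta γ) γ ∈ holoRing,
      (⟨theta, isHolo_theta⟩ : holoRing) ∣ ⟨kappaDefect (zeta γ) γ, hκ⟩ := by
  have hquot : IsHolo fun p =>
      cexp (3 * π * I * (((γ : SL(2, ℤ)) • p.2 : ℍ) : ℂ) / 4) * offDiagonal (modular γ) p :=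
    (((isHolo_const _).mul (isHolo_coe_smul γ)).div (isHolo_const 4) fun _ => by norm_num).cexp.mul
      (isOffDiagonal_offDiagonal (modular γ)).1
  rw [kappaDefect_eq_theta_mul]
  exact ⟨holoRing.mul_mem isHolo_theta hquot, ⟨_, hquot⟩, rfl⟩

end AppellKappa

end

open AppellKappa in
theorem mainTheorem1 :
    ∃ ζ : Gamma12 → ℂ,
      -- `ζ γ` is the multiplier of the theta transformation law, an eighth root of unity
      (∀ (γ : Gamma12) (z : ℂ), IsThetaMultiplier γ z ↔ z = ζ γ) ∧
      (∀ γ : Gamma12, ζ γ ^ 8 = 1 ∧ ζ γ ^ 2 = zetaSq γ) ∧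
      -- `χ` is a character with values in the fourth roots of unity
      (∀ γ δ : Gamma12, chi (γ * δ) = chi γ * chi δ) ∧
      (∀ γ : Gamma12, chi γ ^ 4 = 1) ∧
      -- divisibility by `θ` in the ring of holomorphic functions
      (∃ hθ : theta ∈ holoRing, ∀ γ : Gamma12, ∃ hκ : kappaDefect (ζ γ) γ ∈ holoRing,
        (⟨theta, hθ⟩ : holoRing) ∣ ⟨kappaDefect (ζ γ) γ, hκ⟩) ∧
      -- the pair `(κ, θ)` is a section of a rank-two extension bundle
      (∃ C : UnivGroup → ℂ × UpperHalfPlane → GL (Fin 2) ℂ,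
        IsCocycle C ∧
        IsThetaExtension ζ C ∧
        IsSection C (fun p => ![kappaHalf p, theta p])) :=
  ⟨zeta, fun _ _ => isThetaMultiplier_iff_eq_zeta, fun γ => ⟨zeta_pow_eight γ, zeta_sq γ⟩,
    chi_mul, chi_pow_four, ⟨isHolo_theta, theta_dvd_kappaDefect⟩, extensionCocycle,
    isCocycle_extensionCocycle, isThetaExtension_extensionCocycle, isSection_extensionCocycle⟩
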